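/- Let $M$ be a compact smooth manifold without boundary and let $dx$ be a finite Borel measure on $M$ that is positive on non-empty open sets (for instance a Riemannian volume). Smoothness of maps between (subsets and quotients of) spaces of smooth functions is understood in the usual sense of the Fréchet space $C^\infty(M)$: smooth finite-dimensional families $(u,x)\mapsto p_u(x)$ are mapped to smooth families. Let $$\mathcal P_+(M)=\Big\{\rho\in C^\infty(M):\rho>0,\ \int\rho\,dx=1\Big\},\qquad T^*\mathcal P(M)=\{(\rho,S):\rho\in\mathcal P_+(M),\ S\in C^\infty(M)/\mathbb R\},$$ with the canonical form $\omega^W\big((\dot\rho_1,\dot S_1),(\dot\rho_2,\dot S_2)\big)=\int(\dot\rho_1\dot S_2-\dot\rho_2\dot S_1)\,dx$, where $\int\dot\rho_i\,dx=0$ and $\dot S_i\in C^\infty(M)/\mathbb R$. Let $\mathcal F$ be a real functional on an open set $D\subseteq C^\infty(M)$ containing $\mathcal P_+(M)$, with $L^2$ first variation $\delta\mathcal F:D\to C^\infty(M)$, and assume that $\delta\mathcal F$ is smooth and invertible, i.e. a bijection of $D$ onto $C^\infty(M)$ with smooth inverse. Let $\delta^2\mathcal F(\eta):C^\infty(M)\to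 C^\infty(M)$ be the derivative of $\delta\mathcal F$ at $\eta\in D$. Let $\mathcal C(M)$ be the set of pairs $$\eta=\delta\mathcal F^{-1}\big(\tfrac12(\delta\mathcal F(\rho)+S)\big),\qquad \eta^*=\delta\mathcal F^{-1}\big(\tfrac12(\delta\mathcal F(\rho)-S)\big),\qquad (\rho,S)\in T^*\mathcal P(M);$$ since $S$ is given up to an additive constant, two pairs $(\eta,\eta^*)$, $(\tilde\eta,\tilde\eta^*)$ are identified when $\delta\mathcal F(\tilde\eta)=\delta\mathcal F(\eta)+k$ and $\delta\mathcal F(\tilde\eta^*)=\delta\mathcal F(\eta^*)-k$ for some constant $k\in\mathbb R$. For $(\eta,\eta^*)\in\mathcal C(M)$ put $\rho=\delta\mathcal F^{-1}(\delta\mathcal F(\eta)+\delta\mathcal F(\eta^*))$ and $$\sigma(\eta,\eta^*)=-\tfrac12\,[\delta^2\mathcal F(\eta)]^{-1}\,\delta^2\mathcal F(\rho)\,[\delta^2\mathcal F(\eta^*)]^{-1},$$ $$\omega^{\mathcal C}_{(\eta,\eta^*)}\big((\dot\eta_1,\dot\eta_1^*),(\dot\eta_2,\dot\eta_2^*)\big)=\int\Big(\big(\sigma(\eta,\eta^*)^{-1}\dot\eta_1\big)\,\dot\eta_2^*-\big(\sigma(\eta,\eta^*)^{-1}\dot\eta_2\big)\,\dot\eta_1^*\Big)dx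 .$$ Then all operators $\delta^2\mathcal F(\eta)$, $\eta\in D$, and $\sigma(\eta,\eta^*)$, $(\eta,\eta^*)\in\mathcal C(M)$, are bijective; $\omega^{\mathcal C}$ and $\omega^W$ are (weak) symplectic forms (smooth, skew-symmetric, bilinear, closed and non-degenerate) on $\mathcal C(M)$ and $T^*\mathcal P(M)$, and the generalized Hopf–Cole transformation $s:(\eta,\eta^*)\mapsto(\rho,S)$, $$\delta\mathcal F(\rho)=\delta\mathcal F(\eta)+\delta\mathcal F(\eta^*),\qquad S=\delta\mathcal F(\eta)-\delta\mathcal F(\eta^*),$$ is a symplectomorphism from $(\mathcal C(M),\omega^{\mathcal C})$ onto $(T^*\mathcal P(M),\omega^W)$: a diffeomorphism with $\omega^W(ds\,X,ds\,Y)=\omega^{\mathcal C}(X,Y)$ for all tangent vectors $X,Y$. -/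

import Mathlib

open scoped Manifold ContDiff Topology
open MeasureTheory Diffeology

noncomputable section

/-! ### Subspaces, products and quotients of diffeological spaces -/

/-- The subspace diffeology: a map into a subtype is a plot iff it is a plot of the ambient
space. -/
instance HopfCole.instDiffeologicalSpaceSubtype {Z : Type*} [DiffeologicalSpace Z]
    (P : Z → Prop) : DiffeologicalSpace (Subtype P) where
  plots n := {p | IsPlot (fun u : EuclideanSpace ℝ (Fin n) => (p u : Z))}
  constant_plots x := isPlot_const
  plot_reparam hp hf := isPlot_reparam hp hf
  locality {n p} hp := DiffeologicalSpace.locality fun x => by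
    obtain ⟨u, hu, hx, h⟩ := hp x
    exact ⟨u, hu, hx, fun {m f} hf hf' => h hf hf'⟩

/-- The product diffeology: plots are pairs of plots. -/
instance HopfCole.instDiffeologicalSpaceProd {Y Z : Type*} [DiffeologicalSpace Y]
    [DiffeologicalSpace Z] : DiffeologicalSpace (Y × Z) where
  plots n := {p | IsPlot (fun u : EuclideanSpace ℝ (Fin n) => (p u).1) ∧
    IsPlot (fun u : EuclideanSpace ℝ (Fin n) => (p u).2)}
  constant_plots x := ⟨isPlot_const, isPlot_const⟩
  plot_reparam hp hf := ⟨isPlot_reparam hp.1 hf, isPlot_reparam hp.2 hf⟩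
  locality {n p} hp := by
    refine ⟨DiffeologicalSpace.locality fun x => ?_, DiffeologicalSpace.locality fun x => ?_⟩
    · obtain ⟨u, hu, hx, h⟩ := hp x
      exact ⟨u, hu, hx, fun {m f} hf hf' => (h hf hf').1⟩
    · obtain ⟨u, hu, hx, h⟩ := hp x
      exact ⟨u, hu, hx, fun {m f} hf hf' => (h hf hf').2⟩

/-- The quotient diffeology: the finest diffeology for which the projection is smooth. -/
instance HopfCole.instDiffeologicalSpaceQuotient {Z : Type*} [DiffeologicalSpace Z]
    (r : Setoid Z) : DiffeologicalSpace (Quotient r) :=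
  DiffeologicalSpace.generateFrom
    {q | ∃ p : EuclideanSpace ℝ (Fin q.1) → Z, IsPlot p ∧ q.2 = fun u => Quotient.mk r (p u)}

namespace HopfCole

/-! ### The space of smooth functions -/

/-- `C^∞(M)`, the smooth real functions on a `d`-dimensional manifold without boundary. -/
abbrev SmoothFn (d : ℕ) (M : Type*) [TopologicalSpace M]
    [ChartedSpace (EuclideanSpace ℝ (Fin d)) M] : Type _ :=
  ContMDiffMap (𝓡 d) 𝓘(ℝ, ℝ) M ℝ ∞

/-- The smooth structure of `C^∞(M)`: a family `p u`, `u ∈ ℝⁿ`, of smooth functions is smooth iff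
`(u, x) ↦ p u x` is smooth on `ℝⁿ × M`. For compact `M` a map between open subsets of `C^∞(M)`
is smooth for this structure iff it is smooth in the sense of Fréchet spaces, and the D-topology
is the Fréchet topology. -/
instance instDiffeologicalSpaceSmoothFn {d : ℕ} {M : Type*} [TopologicalSpace M]
    [ChartedSpace (EuclideanSpace ℝ (Fin d)) M] : DiffeologicalSpace (SmoothFn d M) :=
  .ofCorePlotsOn {
    isPlotOn := fun {n u} _ p => ContMDiffOn (𝓘(ℝ, EuclideanSpace ℝ (Fin n)).prod (𝓡 d)) 𝓘(ℝ, ℝ) ∞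
      (fun z : EuclideanSpace ℝ (Fin n) × M => p z.1 z.2) (u ×ˢ Set.univ)
    isPlotOn_congr := fun {n u} _ {p q} h =>
      contMDiffOn_congr (fun z hz => by rw [h hz.1])
    isPlot := fun {n} p => ContMDiff (𝓘(ℝ, EuclideanSpace ℝ (Fin n)).prod (𝓡 d)) 𝓘(ℝ, ℝ) ∞
      (fun z : EuclideanSpace ℝ (Fin n) × M => p z.1 z.2)
    isPlotOn_univ := by
      intro n p
      rw [Set.univ_prod_univ, contMDiffOn_univ]
    isPlot_const := fun f => f.contMDiff.comp contMDiff_snd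
    isPlotOn_reparam := by
      intro n m u v hu hv p f h hp hf
      refine ContMDiffOn.comp (t := u ×ˢ Set.univ)
        (f := fun z : EuclideanSpace ℝ (Fin m) × M => (f z.1, z.2)) hp ?_ ?_
      · exact (hf.contMDiffOn.comp contMDiffOn_fst (fun z hz => hz.1)).prodMk contMDiffOn_snd
      · exact fun z hz => ⟨h hz.1, trivial⟩
    locality := by
      intro n u hu p hp z hz
      obtain ⟨v, hv, hzv, h⟩ := hp z.1 hz.1
      exact ((h z ⟨hzv, trivial⟩).contMDiffAt
        ((hv.prod isOpen_univ).mem_nhds ⟨hzv, trivial⟩)).contMDiffWithinAt }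

section

variable {d : ℕ} {M : Type*} [TopologicalSpace M] [ChartedSpace (EuclideanSpace ℝ (Fin d)) M]

open Classical in
/-- The velocity at `t = 0` of a curve in `C^∞(M)`: the smooth function `w` with
`w(x) = ∂ₜ c(t)(x)` at `t = 0` for all `x` (and `0` if there is none, which does not occur for a
smooth curve). -/
def velocity (c : ℝ → SmoothFn d M) : SmoothFn d M :=
  if h : ∃ w : SmoothFn d M, ∀ x, HasDerivAt (fun t => c t x) (w x) 0 then h.choose else 0

/-- The velocity at `t = 0` of a curve of pairs of smooth functions. -/
def velocityPair (c : ℝ → SmoothFn d M × SmoothFn d M) : SmoothFn d M × SmoothFn d M :=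
  (velocity fun t => (c t).1, velocity fun t => (c t).2)

end

/-! ### Phase spaces -/

/-- A phase space whose points are pairs of smooth functions that belong to a set `carrier`, taken
up to an equivalence relation `rel`. -/
structure PhaseSpace (d : ℕ) (M : Type*) [TopologicalSpace M]
    [ChartedSpace (EuclideanSpace ℝ (Fin d)) M] where
  carrier : Set (SmoothFn d M × SmoothFn d M)
  rel : Setoid carrier

namespace PhaseSpace

variable {d : ℕ} {M : Type*} [TopologicalSpace M] [ChartedSpace (EuclideanSpace ℝ (Fin d)) M]

/-- The points of the phase space, with the quotient of the subspace diffeology. -/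
abbrev Point (A : PhaseSpace d M) : Type _ := Quotient A.rel

/-- The velocity at `t = 0` of a curve of representatives. -/
def vel (A : PhaseSpace d M) (c : ℝ → A.carrier) : SmoothFn d M × SmoothFn d M :=
  velocityPair fun t => (c t : SmoothFn d M × SmoothFn d M)

/-- The tangent vectors of `carrier` at `z`: the velocities of smooth curves in `carrier`
through `z`. -/
def tangent (A : PhaseSpace d M) (z : A.carrier) : Set (SmoothFn d M × SmoothFn d M) :=
  {v | ∃ c : ℝ → A.carrier, DSmooth c ∧ c 0 = z ∧ A.vel c = v}

/-- The vertical tangent vectors at `z`: the velocities of smooth curves through `z` that stay in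
the equivalence class of `z`. The tangent space of the quotient at the class of `z` is
`tangent z` modulo `vertical z`. -/
def vertical (A : PhaseSpace d M) (z : A.carrier) : Set (SmoothFn d M × SmoothFn d M) :=
  {v | ∃ c : ℝ → A.carrier, DSmooth c ∧ c 0 = z ∧ (∀ t, A.rel (c t) z) ∧ A.vel c = v}

/-- The coefficient `(p^*Ω)_u(a, b)` of the pull-back of the 2-form `Ω` by an `n`-parameter
family `p`. -/
def pullbackCoeff (A : PhaseSpace d M)
    (Ω : A.carrier → SmoothFn d M × SmoothFn d M → SmoothFn d M × SmoothFn d M → ℝ)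
    {n : ℕ} (p : EuclideanSpace ℝ (Fin n) → A.carrier) (a b u : EuclideanSpace ℝ (Fin n)) : ℝ :=
  Ω (p u) (A.vel fun t => p (u + t • a)) (A.vel fun t => p (u + t • b))

/-- `Ω` is a (weak) symplectic form on the phase space `carrier / rel`: a skew bilinear form on
tangent vectors which descends to the quotient, is non-degenerate there, is smooth, and is closed.
Smoothness and closedness are those of all its pull-backs to `ℝⁿ`. -/
structure IsSymplecticForm (A : PhaseSpace d M)
    (Ω : A.carrier → SmoothFn d M × SmoothFn d M → SmoothFn d M × SmoothFn d M → ℝ) : Prop where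
  add_left : ∀ z, ∀ v ∈ A.tangent z, ∀ v' ∈ A.tangent z, ∀ w ∈ A.tangent z,
    Ω z (v + v') w = Ω z v w + Ω z v' w
  smul_left : ∀ z, ∀ (r : ℝ), ∀ v ∈ A.tangent z, ∀ w ∈ A.tangent z, Ω z (r • v) w = r * Ω z v w
  skew : ∀ z, ∀ v ∈ A.tangent z, ∀ w ∈ A.tangent z, Ω z v w = -Ω z w v
  /-- The value depends only on the projections of the curves to the quotient. -/
  descends : ∀ c₁ c₂ c₁' c₂' : ℝ → A.carrier, DSmooth c₁ → DSmooth c₂ → DSmooth c₁' →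
    DSmooth c₂' → c₁ 0 = c₂ 0 → c₁' 0 = c₂' 0 → (∀ t, A.rel (c₁ t) (c₁' t)) →
    (∀ t, A.rel (c₂ t) (c₂' t)) →
    Ω (c₁ 0) (A.vel c₁) (A.vel c₂) = Ω (c₁' 0) (A.vel c₁') (A.vel c₂')
  /-- A tangent vector paired to zero with all others vanishes in the quotient. -/
  nondegenerate : ∀ z, ∀ v ∈ A.tangent z, (∀ w ∈ A.tangent z, Ω z v w = 0) → v ∈ A.vertical z
  smooth : ∀ (n : ℕ) (p : EuclideanSpace ℝ (Fin n) → A.carrier), IsPlot p → ∀ a b,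
    ContDiff ℝ ∞ (A.pullbackCoeff Ω p a b)
  /-- `d(p^*Ω)(a, b, c) = 0`. -/
  closed : ∀ (n : ℕ) (p : EuclideanSpace ℝ (Fin n) → A.carrier), IsPlot p → ∀ a b c u,
    fderiv ℝ (A.pullbackCoeff Ω p b c) u a + fderiv ℝ (A.pullbackCoeff Ω p c a) u b +
      fderiv ℝ (A.pullbackCoeff Ω p a b) u c = 0

/-- The map of representatives `f` induces a symplectomorphism `(A, ΩA) → (B, ΩB)`: both forms
are symplectic, `f` is smooth and descends to a diffeomorphism of the quotients, and
`ΩB(df(X), df(Y)) = ΩA(X, Y)`. -/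
structure IsSymplectomorphism (A B : PhaseSpace d M)
    (ΩA : A.carrier → SmoothFn d M × SmoothFn d M → SmoothFn d M × SmoothFn d M → ℝ)
    (ΩB : B.carrier → SmoothFn d M × SmoothFn d M → SmoothFn d M × SmoothFn d M → ℝ)
    (f : A.carrier → B.carrier) : Prop where
  symplectic_source : A.IsSymplecticForm ΩA
  symplectic_target : B.IsSymplecticForm ΩB
  smooth : DSmooth f
  diffeo : ∃ e : A.Point ≃ B.Point,
    (∀ z, e (Quotient.mk A.rel z) = Quotient.mk B.rel (f z)) ∧ DSmooth e ∧ DSmooth e.symm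
  pullback : ∀ c₁ c₂ : ℝ → A.carrier, DSmooth c₁ → DSmooth c₂ → c₁ 0 = c₂ 0 →
    ΩB (f (c₁ 0)) (B.vel fun t => f (c₁ t)) (B.vel fun t => f (c₂ t)) =
      ΩA (c₁ 0) (A.vel c₁) (A.vel c₂)

end PhaseSpace

/-! ### The Wasserstein cotangent bundle -/

section

variable {d : ℕ} {M : Type*} [TopologicalSpace M] [ChartedSpace (EuclideanSpace ℝ (Fin d)) M]
  [MeasurableSpace M]

/-- `P₊(M)`, the smooth strictly positive probability densities with respect to `μ`. -/
def densities (μ : Measure M) : Set (SmoothFn d M) :=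
  {ρ | (∀ x, 0 < ρ x) ∧ ∫ x, ρ x ∂μ = 1}

/-- `T^*P(M) = {(ρ, S) : ρ ∈ P₊(M), S ∈ C^∞(M) / ℝ}`. -/
def cotangentBundle (μ : Measure M) : PhaseSpace d M where
  carrier := {q | q.1 ∈ densities μ}
  rel :=
    { r := fun q q' => q.1.1 = q'.1.1 ∧ ∃ k : ℝ, ∀ x, q'.1.2 x = q.1.2 x + k
      iseqv :=
        { refl := fun q => ⟨rfl, 0, fun x => (add_zero _).symm⟩
          symm := fun {q q'} h => by
            obtain ⟨h₁, k, h₂⟩ := h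
            exact ⟨h₁.symm, -k, fun x => by rw [h₂ x]; ring⟩
          trans := fun {q q' q''} h h' => by
            obtain ⟨h₁, k, h₂⟩ := h
            obtain ⟨h₁', k', h₂'⟩ := h'
            exact ⟨h₁.trans h₁', k + k', fun x => by rw [h₂' x, h₂ x]; ring⟩ } }

/-- The canonical form `∫ (ρ̇₁ Ṡ₂ - ρ̇₂ Ṡ₁) dx` on `T^*P(M)`. -/
def wassersteinForm (μ : Measure M) (_ : (cotangentBundle (d := d) μ).carrier)
    (v w : SmoothFn d M × SmoothFn d M) : ℝ :=
  ∫ x, (v.1 x * w.2 x - w.1 x * v.2 x) ∂μ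

/-! ### Potentials with invertible first variation -/

/-- A potential energy `F` on an open set `dom` of smooth functions that contains the probability
densities, together with its first variation (`L²` gradient) `δF : dom → C^∞(M)`, which is smooth
and invertible: a bijection of `dom` onto `C^∞(M)` with smooth inverse. (The values of `F` and
`δF` off `dom` play no role.) -/
structure InvertiblePotential (d : ℕ) {M : Type*} [TopologicalSpace M]
    [ChartedSpace (EuclideanSpace ℝ (Fin d)) M] [MeasurableSpace M] (μ : Measure M) where
  dom : Set (SmoothFn d M)
  F : SmoothFn d M → ℝ
  δF : SmoothFn d M → SmoothFn d M
  isOpen_dom : IsOpen[dTopology] dom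
  densities_subset : densities μ ⊆ dom
  isFirstVariation : ∀ η ∈ dom, ∀ v : SmoothFn d M,
    HasDerivAt (fun t : ℝ => F (η + t • v)) (∫ x, δF η x * v x ∂μ) 0
  smooth_δF : DSmooth fun η : dom => δF η
  bijOn_δF : Set.BijOn δF dom Set.univ
  smooth_inv : DSmooth (Function.invFunOn δF dom)

namespace InvertiblePotential

variable {μ : Measure M} (Φ : InvertiblePotential d μ)

/-- `(δF)⁻¹ : C^∞(M) → dom`. -/
def δFinv : SmoothFn d M → SmoothFn d M := Function.invFunOn Φ.δF Φ.dom

theorem δF_δFinv (f : SmoothFn d M) : Φ.δF (Φ.δFinv f) = f :=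
  Φ.bijOn_δF.surjOn.rightInvOn_invFunOn (Set.mem_univ f)

theorem δFinv_δF {η : SmoothFn d M} (hη : η ∈ Φ.dom) : Φ.δFinv (Φ.δF η) = η :=
  Φ.bijOn_δF.injOn.leftInvOn_invFunOn hη

/-- The second variation (`L²` Hessian) `δ²F(η)` as an operator:
`v ↦ ∫ δ²F(η)(·, y) v(y) dy`, the derivative of `δF` at `η` in the direction `v`. -/
def secondVariation (η v : SmoothFn d M) : SmoothFn d M :=
  velocity fun t => Φ.δF (η + t • v)

/-- The density `ρ = (δF)⁻¹(δF(η) + δF(η^*))`. -/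
def density (z : SmoothFn d M × SmoothFn d M) : SmoothFn d M :=
  Φ.δFinv (Φ.δF z.1 + Φ.δF z.2)

/-- `σ(η, η^*) = -½ [δ²F(η)]⁻¹ δ²F(ρ) [δ²F(η^*)]⁻¹`. -/
def sigma (z : SmoothFn d M × SmoothFn d M) (α : SmoothFn d M) : SmoothFn d M :=
  (-(1 / 2) : ℝ) • Function.invFun (Φ.secondVariation z.1)
    (Φ.secondVariation (Φ.density z) (Function.invFun (Φ.secondVariation z.2) α))

/-- The space of Hopf–Cole variables
`η = (δF)⁻¹(½(δF(ρ) + S))`, `η^* = (δF)⁻¹(½(δF(ρ) - S))` with `(ρ, S) ∈ T^*P(M)`.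
As `S` is given up to an additive constant, `(δF(η), δF(η^*))` is given up to
`(δF(η) + k, δF(η^*) - k)`. -/
def hopfColeSpace : PhaseSpace d M where
  carrier := {z | ∃ ρ ∈ densities μ, ∃ S : SmoothFn d M,
    z.1 = Φ.δFinv ((1 / 2 : ℝ) • (Φ.δF ρ + S)) ∧ z.2 = Φ.δFinv ((1 / 2 : ℝ) • (Φ.δF ρ - S))}
  rel :=
    { r := fun z z' => ∃ k : ℝ, ∀ x,
        Φ.δF z'.1.1 x = Φ.δF z.1.1 x + k ∧ Φ.δF z'.1.2 x = Φ.δF z.1.2 x - k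
      iseqv :=
        { refl := fun z => ⟨0, fun x => ⟨(add_zero _).symm, (sub_zero _).symm⟩⟩
          symm := fun {z z'} h => by
            obtain ⟨k, h⟩ := h
            exact ⟨-k, fun x => ⟨by rw [(h x).1]; ring, by rw [(h x).2]; ring⟩⟩
          trans := fun {z z' z''} h h' => by
            obtain ⟨k, h⟩ := h
            obtain ⟨k', h'⟩ := h'
            exact ⟨k + k', fun x => ⟨by rw [(h' x).1, (h x).1]; ring,
              by rw [(h' x).2, (h x).2]; ring⟩⟩ } }

/-- The 2-form `∫ (σ(η, η^*)⁻¹ η̇₁) η̇₂^* - (σ(η, η^*)⁻¹ η̇₂) η̇₁^* dx` on Hopf–Cole variables: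
the form whose Hamiltonian flows are `∂ₜη = σ ∂K/∂η^*`, `∂ₜη^* = -σ^T ∂K/∂η`. -/
def hopfColeForm (z : Φ.hopfColeSpace.carrier) (v w : SmoothFn d M × SmoothFn d M) : ℝ :=
  ∫ x, (Function.invFun (Φ.sigma z.1) v.1 x * w.2 x -
    Function.invFun (Φ.sigma z.1) w.1 x * v.2 x) ∂μ

theorem density_mem (z : Φ.hopfColeSpace.carrier) :
    Φ.density z.1 ∈ densities μ := by
  obtain ⟨z, ρ, hρ, S, h₁, h₂⟩ := z
  have h : Φ.δF z.1 + Φ.δF z.2 = Φ.δF ρ := by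
    rw [h₁, h₂, δF_δFinv, δF_δFinv, ← smul_add]
    rw [show Φ.δF ρ + S + (Φ.δF ρ - S) = (2 : ℝ) • Φ.δF ρ by rw [two_smul]; abel, smul_smul]
    norm_num
  change Φ.density z ∈ densities μ
  rw [density, h, δFinv_δF Φ (Φ.densities_subset hρ)]
  exact hρ

/-- The generalized Hopf–Cole transformation `(η, η^*) ↦ (ρ, S)`, with
`δF(ρ) = δF(η) + δF(η^*)` and `S = δF(η) - δF(η^*)`. -/
def hopfCole (z : Φ.hopfColeSpace.carrier) : (cotangentBundle (d := d) μ).carrier :=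
  ⟨(Φ.density z.1, Φ.δF z.1.1 - Φ.δF z.1.2), Φ.density_mem z⟩

end InvertiblePotential

end

end HopfCole

/-
By construction `δF(ρ) = δF(η) + δF(η^*)` and `S = δF(η) - δF(η^*)`, so `s` is, in the coordinates
given by `δF`, the linear isomorphism `(a, b) ↦ (a + b, a - b)`. The chain rule in `C^∞(M)` (by
Hadamard's lemma, a smooth curve through `f` is `f + t w(t)` with `w` smooth) shows that `δ²F(η)` is
invertible, with inverse the derivative of `(δF)⁻¹`, and gives the differential of `s`. As
`∫ (δ²F(η) v) w dx` is a second directional derivative of `F`, it is symmetric in `v` and `w` by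
Schwarz's theorem; so is `∫ ([δ²F(ρ)]⁻¹ v) w dx`. With `a = δ²F(η) η̇` and `b = δ²F(η^*) η̇^*`, the
terms `a₁, a₂` and `b₁, b₂` of `s^* ω^W` therefore cancel, and the mixed terms add up to
`-2 ∫ [δ²F(ρ)]⁻¹ a₁ b₂ - [δ²F(ρ)]⁻¹ a₂ b₁ dx = ω^C`. Hence `ω^C = s^* ω^W` inherits every
property of a symplectic form from `ω^W`, which is closed because its coefficients do not depend on
the base point.
-/

namespace HopfCole

section ParametricIntegral

variable {V : Type*} [NormedAddCommGroup V] [NormedSpace ℝ V]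
  {E : Type*} [NormedAddCommGroup E] [NormedSpace ℝ E] {H : Type*} [TopologicalSpace H]
  {I : ModelWithCorners ℝ E H} {N : Type*} [TopologicalSpace N] [ChartedSpace H N]
  {F : Type*} [NormedAddCommGroup F] [NormedSpace ℝ F] {f : V × N → F}

theorem contDiff_slice (hf : ContMDiff (𝓘(ℝ, V).prod I) 𝓘(ℝ, F) ∞ f) (x : N) :
    ContDiff ℝ ∞ fun u => f (u, x) :=
  (hf.comp (contMDiff_id.prodMk contMDiff_const)).contDiff

variable [IsManifold I ∞ N]

theorem contMDiff_fderiv_slice (hf : ContMDiff (𝓘(ℝ, V).prod I) 𝓘(ℝ, F) ∞ f) :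
    ContMDiff (𝓘(ℝ, V).prod I) 𝓘(ℝ, V →L[ℝ] F) ∞
      fun z : V × N => fderiv ℝ (fun u => f (u, z.2)) z.1 := by
  intro z₀
  have : IsManifold I 1 N := .of_le (n := ∞) (by norm_cast)
  have hswap : ContMDiff ((𝓘(ℝ, V).prod I).prod 𝓘(ℝ, V)) 𝓘(ℝ, F) ∞
      fun w : (V × N) × V => f (w.2, w.1.2) :=
    hf.comp (contMDiff_snd.prodMk (contMDiff_snd.comp contMDiff_fst))
  have hmfderiv := ContMDiffAt.mfderiv (fun (z : V × N) (u : V) => f (u, z.2)) (fun z => z.1)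
    (x₀ := z₀) (m := ∞) hswap.contMDiffAt contMDiffAt_fst (by simp)
  refine hmfderiv.congr_of_eventuallyEq (.of_forall fun z => ?_)
  -- In the model spaces `V` and `F` the tangent coordinates are the identity.
  exact mfderiv_eq_fderiv.symm.trans
    (congrFun (inTangentCoordinates_model_space (I := 𝓘(ℝ, V)) (I' := 𝓘(ℝ, F))
      (fun z : V × N => z.1) f
      (fun z => mfderiv 𝓘(ℝ, V) 𝓘(ℝ, F) (fun u => f (u, z.2)) z.1) z₀) z).symm

theorem contMDiff_fderiv_slice_apply (hf : ContMDiff (𝓘(ℝ, V).prod I) 𝓘(ℝ, F) ∞ f) (a : V) :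
    ContMDiff (𝓘(ℝ, V).prod I) 𝓘(ℝ, F) ∞
      fun z : V × N => fderiv ℝ (fun u => f (u, z.2)) z.1 a :=
  (contMDiff_fderiv_slice hf).clm_apply contMDiff_const

variable [FiniteDimensional ℝ V] [MeasurableSpace N] [OpensMeasurableSpace N]
  {μ : Measure N} [IsFiniteMeasureOnCompacts μ] {K : Set N}

theorem hasFDerivAt_setIntegral_slice (hK : IsCompact K) (hKm : MeasurableSet K)
    (hf : ContMDiff (𝓘(ℝ, V).prod I) 𝓘(ℝ, F) ∞ f) (u : V) :
    HasFDerivAt (fun u => ∫ x in K, f (u, x) ∂μ)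
      (∫ x in K, fderiv ℝ (fun u => f (u, x)) u ∂μ) u := by
  have hf' := (contMDiff_fderiv_slice hf).continuous
  obtain ⟨C, hC⟩ := ((isCompact_closedBall u 1).prod hK).bddAbove_image hf'.norm.continuousOn
  have hslice (v : V) : ContinuousOn (fun x => f (v, x)) K :=
    (hf.continuous.comp (Continuous.prodMk_right v)).continuousOn
  have hslice' : ContinuousOn (fun x => fderiv ℝ (fun u => f (u, x)) u) K :=
    (hf'.comp (Continuous.prodMk_right u)).continuousOn
  refine hasFDerivAt_integral_of_dominated_of_fderiv_le (𝕜 := ℝ) (bound := fun _ => C)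
    (F' := fun u x => fderiv ℝ (fun u => f (u, x)) u) (Metric.closedBall_mem_nhds u one_pos)
    (.of_forall fun v => (hslice v).aestronglyMeasurable_of_isCompact hK hKm)
    ((hslice u).integrableOn_compact' hK hKm)
    (hslice'.aestronglyMeasurable_of_isCompact hK hKm) ?_ (integrableOn_const hK.measure_ne_top)
    (.of_forall fun x v _ => ((contDiff_slice hf x).differentiable (by simp) v).hasFDerivAt)
  exact (ae_restrict_iff' hKm).2 (.of_forall fun x hx v hv => hC ⟨(v, x), ⟨hv, hx⟩, rfl⟩)

theorem fderiv_setIntegral_slice_apply (hK : IsCompact K) (hKm : MeasurableSet K)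
    (hf : ContMDiff (𝓘(ℝ, V).prod I) 𝓘(ℝ, F) ∞ f) (u a : V) :
    fderiv ℝ (fun u => ∫ x in K, f (u, x) ∂μ) u a =
      ∫ x in K, fderiv ℝ (fun u => f (u, x)) u a ∂μ := by
  have hint : IntegrableOn (fun x => fderiv ℝ (fun u => f (u, x)) u) K μ :=
    ((contMDiff_fderiv_slice hf).continuous.comp
      (Continuous.prodMk_right u)).continuousOn.integrableOn_compact' hK hKm
  rw [(hasFDerivAt_setIntegral_slice hK hKm hf u).fderiv]
  exact ContinuousLinearMap.integral_apply hint a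

theorem contDiff_setIntegral_slice (hK : IsCompact K) (hKm : MeasurableSet K)
    (hf : ContMDiff (𝓘(ℝ, V).prod I) 𝓘(ℝ, F) ∞ f) :
    ContDiff ℝ ∞ fun u => ∫ x in K, f (u, x) ∂μ := by
  rw [contDiff_infty]
  intro n
  induction n generalizing f with
  | zero =>
    exact contDiff_zero.2 <| continuous_iff_continuousAt.2 fun u =>
      (hasFDerivAt_setIntegral_slice hK hKm hf u).continuousAt
  | succ n ih =>
    rw [Nat.cast_add_one, contDiff_succ_iff_fderiv_apply]
    refine ⟨fun u => (hasFDerivAt_setIntegral_slice hK hKm hf u).differentiableAt, by simp,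
      fun a => ?_⟩
    simp only [fderiv_setIntegral_slice_apply hK hKm hf]
    exact ih (contMDiff_fderiv_slice_apply hf a)

end ParametricIntegral

section Hadamard

variable {E : Type*} [NormedAddCommGroup E] [NormedSpace ℝ E] [FiniteDimensional ℝ E]
  {H : Type*} [TopologicalSpace H]
  {I : ModelWithCorners ℝ E H} [I.Boundaryless] {N : Type*} [TopologicalSpace N] [ChartedSpace H N]
  [IsManifold I ∞ N]
  {E' : Type*} [NormedAddCommGroup E'] [NormedSpace ℝ E'] {H' : Type*} [TopologicalSpace H']
  {J : ModelWithCorners ℝ E' H'} {P : Type*} [TopologicalSpace P] [ChartedSpace H' P]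
  {F : Type*} [NormedAddCommGroup F] [NormedSpace ℝ F]

theorem exists_contMDiff_comp_extChartAt_eventuallyEq {f : N × P → F}
    (hf : ContMDiff (I.prod J) 𝓘(ℝ, F) ∞ f) (x₀ : N) :
    ∃ g : E × P → F, ContMDiff (𝓘(ℝ, E).prod J) 𝓘(ℝ, F) ∞ g ∧
      ∀ᶠ x in 𝓝 x₀, ∀ y, f (x, y) = g (extChartAt I x₀ x, y) := by
  set φ := extChartAt I x₀
  have hφ : IsOpen φ.target := isOpen_extChartAt_target x₀
  obtain ⟨χ, hχ⟩ : ∃ χ : ContDiffBump (φ x₀), tsupport χ ⊆ φ.target := by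
    obtain ⟨ε, hε, hball⟩ := Metric.isOpen_iff.1 hφ _ (mem_extChartAt_target x₀)
    let χ : ContDiffBump (φ x₀) := ⟨ε / 4, ε / 2, by positivity, by linarith⟩
    refine ⟨χ, χ.tsupport_eq.trans_subset (.trans ?_ hball)⟩
    exact Metric.closedBall_subset_ball (half_lt_self hε)
  refine ⟨fun z => χ z.1 • f (φ.symm z.1, z.2), fun z => ?_, ?_⟩
  · by_cases hz : z.1 ∈ φ.target
    · have hsymm : ContMDiffAt 𝓘(ℝ, E) I ∞ φ.symm z.1 :=
        (contMDiffOn_extChartAt_symm x₀).contMDiffAt (hφ.mem_nhds hz)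
      exact (χ.contDiff.contMDiff.contMDiffAt.comp z contMDiffAt_fst).smul
        (hf.contMDiffAt.comp z ((hsymm.comp z contMDiffAt_fst).prodMk contMDiffAt_snd))
    · refine (contMDiffAt_const (c := (0 : F))).congr_of_eventuallyEq ?_
      have hzero : ∀ᶠ y in 𝓝 z.1, χ y = 0 :=
        notMem_tsupport_iff_eventuallyEq.1 fun h => hz (hχ h)
      filter_upwards [continuousAt_fst.eventually hzero] with y hy
      rw [hy, zero_smul]
  · have hone : ∀ᶠ x in 𝓝 x₀, χ (φ x) = 1 :=
      (continuousAt_extChartAt x₀).eventually χ.eventuallyEq_one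
    filter_upwards [hone, extChartAt_source_mem_nhds (I := I) x₀] with x hx hxs y
    rw [hx, one_smul, φ.left_inv hxs]

theorem contMDiff_setIntegral [IsManifold J ∞ P] [MeasurableSpace P] [OpensMeasurableSpace P]
    {μ : Measure P} [IsFiniteMeasureOnCompacts μ] {K : Set P} (hK : IsCompact K)
    (hKm : MeasurableSet K) {f : N × P → F} (hf : ContMDiff (I.prod J) 𝓘(ℝ, F) ∞ f) :
    ContMDiff I 𝓘(ℝ, F) ∞ fun x => ∫ y in K, f (x, y) ∂μ := by
  intro x₀
  obtain ⟨g, hg, hfg⟩ := exists_contMDiff_comp_extChartAt_eventuallyEq hf x₀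
  have hG : ContDiff ℝ ∞ fun u => ∫ y in K, g (u, y) ∂μ := contDiff_setIntegral_slice hK hKm hg
  refine (hG.contMDiff.contMDiffAt.comp x₀ contMDiffAt_extChartAt).congr_of_eventuallyEq ?_
  filter_upwards [hfg] with x hx
  simp only [hx, Function.comp_apply]

theorem exists_contMDiff_eq_add_smul [CompleteSpace F] {f : ℝ × N → F}
    (hf : ContMDiff (𝓘(ℝ, ℝ).prod I) 𝓘(ℝ, F) ∞ f) :
    ∃ g : ℝ × N → F, ContMDiff (𝓘(ℝ, ℝ).prod I) 𝓘(ℝ, F) ∞ g ∧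
      ∀ t x, f (t, x) = f (0, x) + t • g (t, x) := by
  let f' : ℝ × N → F := fun z => fderiv ℝ (fun t => f (t, z.2)) z.1 1
  have hf' : ContMDiff (𝓘(ℝ, ℝ).prod I) 𝓘(ℝ, F) ∞ f' := contMDiff_fderiv_slice_apply hf 1
  refine ⟨fun z => ∫ s in Set.Icc (0 : ℝ) 1, f' (s * z.1, z.2), ?_, fun t x => ?_⟩
  · refine contMDiff_setIntegral (J := 𝓘(ℝ, ℝ)) isCompact_Icc measurableSet_Icc
      (f := fun w : (ℝ × N) × ℝ => f' (w.2 * w.1.1, w.1.2)) (hf'.comp ?_)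
    exact (contMDiff_snd.mul (contMDiff_fst.comp contMDiff_fst)).prodMk
      (contMDiff_snd.comp contMDiff_fst)
  · have hderiv (s : ℝ) : HasDerivAt (fun s : ℝ => f (s * t, x)) (t • f' (s * t, x)) s := by
      have hslice := (contDiff_slice hf x).differentiable (by simp) (s * t)
      simpa [Function.comp_def, f'] using hslice.hasDerivAt.scomp s (hasDerivAt_mul_const t)
    have hcont : Continuous fun s : ℝ => t • f' (s * t, x) := by
      have := hf'.continuous
      fun_prop
    have hftc := intervalIntegral.integral_eq_sub_of_hasDerivAt (a := 0) (b := 1)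
      (fun s _ => hderiv s) (hcont.intervalIntegrable _ _)
    rw [intervalIntegral.integral_smul, intervalIntegral.integral_of_le zero_le_one,
      ← integral_Icc_eq_integral_Ioc, one_mul, zero_mul] at hftc
    rw [hftc, add_sub_cancel]

end Hadamard

section Calculus

theorem fderiv_partialDeriv_comm {F : Type*} [NormedAddCommGroup F] [NormedSpace ℝ F]
    {f f₁ f₂ : ℝ × ℝ → F} {z₀ : ℝ × ℝ}
    (h₁ : ∀ᶠ z in 𝓝 z₀, HasDerivAt (fun s => f (s, z.2)) (f₁ z) z.1)
    (h₂ : ∀ᶠ z in 𝓝 z₀, HasDerivAt (fun t => f (z.1, t)) (f₂ z) z.2)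
    (hf₁ : ContDiffAt ℝ 1 f₁ z₀) (hf₂ : ContDiffAt ℝ 1 f₂ z₀) :
    fderiv ℝ f₁ z₀ (0, 1) = fderiv ℝ f₂ z₀ (1, 0) := by
  let f' : ℝ × ℝ → ℝ × ℝ →L[ℝ] F := fun z =>
    (ContinuousLinearMap.toSpanSingleton ℝ (f₁ z)).coprod
      (ContinuousLinearMap.toSpanSingleton ℝ (f₂ z))
  have hf : ∀ᶠ z in 𝓝 z₀, HasFDerivAt f (f' z) z := by
    have hcont {g : ℝ × ℝ → F} {z : ℝ × ℝ} (hg : ContDiffAt ℝ 1 g z) :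
        ContinuousAt (fun y => ContinuousLinearMap.toSpanSingleton ℝ (g y)) z :=
      (ContinuousLinearMap.toSpanSingletonCLE (𝕜 := ℝ)).continuous.continuousAt.comp
        hg.continuousAt
    filter_upwards [h₁.eventually_nhds, h₂.eventually_nhds, hf₁.eventually (by simp),
      hf₂.eventually (by simp)] with z hz₁ hz₂ hfz₁ hfz₂
    exact (hasStrictFDerivAt_uncurry_coprod (f := fun s t => f (s, t))
      (f₁ := fun s t => ContinuousLinearMap.toSpanSingleton ℝ (f₁ (s, t)))
      (f₂ := fun s t => ContinuousLinearMap.toSpanSingleton ℝ (f₂ (s, t)))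
      (hz₁.mono fun _ h => h.hasFDerivAt) (hz₂.mono fun _ h => h.hasFDerivAt)
      (hcont hfz₁) (hcont hfz₂)).hasFDerivAt
  have hf' (z : ℝ × ℝ) : f' z = (ContinuousLinearMap.fst ℝ ℝ ℝ).smulRight (f₁ z) +
      (ContinuousLinearMap.snd ℝ ℝ ℝ).smulRight (f₂ z) := by
    ext <;> simp [f']
  have hd₁ := (hf₁.differentiableAt one_ne_zero).hasFDerivAt
  have hd₂ := (hf₂.differentiableAt one_ne_zero).hasFDerivAt
  have hf'' : HasFDerivAt f'
      (((ContinuousLinearMap.smulRightL ℝ (ℝ × ℝ) F (ContinuousLinearMap.fst ℝ ℝ ℝ)).comp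
        (fderiv ℝ f₁ z₀)) +
      ((ContinuousLinearMap.smulRightL ℝ (ℝ × ℝ) F (ContinuousLinearMap.snd ℝ ℝ ℝ)).comp
        (fderiv ℝ f₂ z₀))) z₀ := by
    rw [funext hf']
    exact ((ContinuousLinearMap.smulRightL ℝ (ℝ × ℝ) F _).hasFDerivAt.comp z₀ hd₁).add
      ((ContinuousLinearMap.smulRightL ℝ (ℝ × ℝ) F _).hasFDerivAt.comp z₀ hd₂)
  simpa using second_derivative_symmetric_of_eventually hf hf'' (0, 1) (1, 0)

theorem exists_contDiff_eventuallyEq_id {V : Type*} [NormedAddCommGroup V] [NormedSpace ℝ V]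
    [HasContDiffBump V] {u₀ : V} {s : Set V} (hs : s ∈ 𝓝 u₀) :
    ∃ φ : V → V, ContDiff ℝ ∞ φ ∧ (∀ u, φ u ∈ s) ∧ φ =ᶠ[𝓝 u₀] id := by
  obtain ⟨ε, hε, hball⟩ := Metric.mem_nhds_iff.1 hs
  let χ : ContDiffBump u₀ := ⟨ε / 2, ε, by positivity, by linarith⟩
  refine ⟨fun u => u₀ + χ u • (u - u₀), ?_, fun u => hball ?_, ?_⟩
  · exact contDiff_const.add (χ.contDiff.smul (contDiff_id.sub contDiff_const))
  · rw [mem_ball_iff_norm, add_sub_cancel_left, norm_smul, Real.norm_of_nonneg χ.nonneg]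
    rcases lt_or_ge (dist u u₀) ε with hu | hu
    · exact (mul_le_of_le_one_left (norm_nonneg _) χ.le_one).trans_lt (by rwa [← dist_eq_norm])
    · rwa [χ.zero_of_le_dist hu, zero_mul]
  · filter_upwards [χ.eventuallyEq_one] with u hu
    simp [hu]

end Calculus

section SmoothFamily

variable {d : ℕ} {M : Type*} [TopologicalSpace M] [ChartedSpace (EuclideanSpace ℝ (Fin d)) M]

/-- `w` is the velocity of the curve `c` at `t = 0`. -/
def HasVelocity (c : ℝ → SmoothFn d M) (w : SmoothFn d M) : Prop :=
  ∀ x, HasDerivAt (fun t => c t x) (w x) 0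

namespace HasVelocity

variable {c c' : ℝ → SmoothFn d M} {v w : SmoothFn d M}

theorem unique (hv : HasVelocity c v) (hw : HasVelocity c w) : v = w :=
  ContMDiffMap.ext fun x => (hv x).unique (hw x)

theorem velocity_eq (hw : HasVelocity c w) : velocity c = w := by
  have h : ∃ w : SmoothFn d M, ∀ x, HasDerivAt (fun t => c t x) (w x) 0 := ⟨w, hw⟩
  rw [velocity, dif_pos h]
  exact unique (c := c) h.choose_spec hw

theorem congr (hw : HasVelocity c w) (h : c' =ᶠ[𝓝 0] c) : HasVelocity c' w := fun x =>
  (hw x).congr_of_eventuallyEq (h.mono fun t ht => by simp only [ht])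

theorem add (hv : HasVelocity c v) (hw : HasVelocity c' w) :
    HasVelocity (fun t => c t + c' t) (v + w) := fun x => (hv x).add (hw x)

theorem sub (hv : HasVelocity c v) (hw : HasVelocity c' w) :
    HasVelocity (fun t => c t - c' t) (v - w) := fun x => (hv x).sub (hw x)

end HasVelocity

theorem hasVelocity_const (f : SmoothFn d M) : HasVelocity (fun _ => f) 0 :=
  fun x => hasDerivAt_const 0 (f x)

theorem hasVelocity_add_smul_const (f v : SmoothFn d M) :
    HasVelocity (fun t => f + t • v) v :=
  fun x => (hasDerivAt_mul_const (v x)).const_add (f x)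

/-- The derivative at `u` in the direction `a` of a map `G` into `C^∞(M)`. It covers both families
with finitely many parameters and, for `V = C^∞(M)`, the operators `δF` and `(δF)⁻¹`. -/
noncomputable def dirDeriv {V : Type*} [AddCommGroup V] [Module ℝ V] (G : V → SmoothFn d M)
    (u a : V) : SmoothFn d M :=
  velocity fun t : ℝ => G (u + t • a)

variable {V W : Type*} [NormedAddCommGroup V] [NormedSpace ℝ V] [NormedAddCommGroup W]
  [NormedSpace ℝ W]

/-- A jointly smooth family of smooth functions with parameters in a normed space. -/
def SmoothFamily (p : V → SmoothFn d M) : Prop :=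
  ContMDiff (𝓘(ℝ, V).prod (𝓡 d)) 𝓘(ℝ, ℝ) ∞ fun z : V × M => p z.1 z.2

/-- The germ at `u₀` of a smooth family: `p` agrees near `u₀` with a globally defined one. -/
def SmoothFamilyAt (p : V → SmoothFn d M) (u₀ : V) : Prop :=
  ∃ q, SmoothFamily q ∧ p =ᶠ[𝓝 u₀] q

theorem eventually_add_smul {P : V → Prop} {u : V} (h : ∀ᶠ y in 𝓝 u, P y) (a : V) :
    ∀ᶠ t : ℝ in 𝓝 0, P (u + t • a) :=
  (Continuous.tendsto' (by fun_prop) _ _ (by simp)).eventually h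

namespace SmoothFamily

variable {p q : V → SmoothFn d M}

theorem const (f : SmoothFn d M) : SmoothFamily fun _ : V => f :=
  f.contMDiff.comp contMDiff_snd

theorem comp (hp : SmoothFamily p) {φ : W → V} (hφ : ContDiff ℝ ∞ φ) :
    SmoothFamily fun w => p (φ w) :=
  ContMDiff.comp (g := fun z : V × M => p z.1 z.2) (f := fun z : W × M => (φ z.1, z.2)) hp
    ((hφ.contMDiff.comp contMDiff_fst).prodMk contMDiff_snd)

theorem add (hp : SmoothFamily p) (hq : SmoothFamily q) : SmoothFamily fun u => p u + q u :=
  ContMDiff.add hp hq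

theorem sub (hp : SmoothFamily p) (hq : SmoothFamily q) : SmoothFamily fun u => p u - q u :=
  ContMDiff.sub hp hq

theorem mul (hp : SmoothFamily p) (hq : SmoothFamily q) : SmoothFamily fun u => p u * q u :=
  ContMDiff.mul hp hq

theorem smul {φ : V → ℝ} (hφ : ContDiff ℝ ∞ φ) (hp : SmoothFamily p) :
    SmoothFamily fun u => φ u • p u :=
  ContMDiff.mul (f := fun z : V × M => φ z.1) (hφ.contMDiff.comp contMDiff_fst) hp

theorem smoothFamilyAt (hp : SmoothFamily p) (u : V) : SmoothFamilyAt p u :=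
  ⟨p, hp, .rfl⟩

theorem contDiff_apply (hp : SmoothFamily p) (x : M) : ContDiff ℝ ∞ fun u => p u x :=
  contDiff_slice hp x

theorem differentiableAt_apply (hp : SmoothFamily p) (x : M) (u : V) :
    DifferentiableAt ℝ (fun u => p u x) u :=
  (hp.contDiff_apply x).differentiable (by simp) u

theorem hasVelocity_add_smul {c : ℝ → SmoothFn d M} (hc : SmoothFamily c) (f : SmoothFn d M) :
    HasVelocity (fun t => f + t • c t) (c 0) := fun x => by
  have h := (hasDerivAt_id (0 : ℝ)).mul (hc.differentiableAt_apply x 0).hasDerivAt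
  simp only [id_eq, one_mul, zero_mul, add_zero] at h
  exact h.const_add (f x)

theorem of_comp_toEuclidean_symm [FiniteDimensional ℝ V]
    (hp : SmoothFamily fun u => p ((toEuclidean (E := V)).symm u)) : SmoothFamily p := by
  simpa only [ContinuousLinearEquiv.symm_apply_apply] using
    hp.comp (toEuclidean (E := V)).contDiff

theorem isOpen_preimage [FiniteDimensional ℝ V] (hp : SmoothFamily p) {D : Set (SmoothFn d M)}
    (hD : IsOpen[dTopology] D) : IsOpen (p ⁻¹' D) := by
  let e := toEuclidean (E := V)
  have h : IsOpen ((fun u => p (e.symm u)) ⁻¹' D) :=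
    isOpen_iff_preimages_plots.1 hD _ _ (hp.comp e.symm.contDiff)
  simpa only [Set.preimage_preimage, e.symm_apply_apply] using h.preimage e.continuous

variable [IsManifold (𝓡 d) ∞ M]

theorem hasVelocity_dirDeriv (hp : SmoothFamily p) (u a : V) :
    HasVelocity (fun t : ℝ => p (u + t • a)) (dirDeriv p u a) := by
  let w : SmoothFn d M := ⟨fun x => fderiv ℝ (fun u => p u x) u a,
    (contMDiff_fderiv_slice_apply hp a).comp (contMDiff_const.prodMk contMDiff_id)⟩
  have hw : HasVelocity (fun t : ℝ => p (u + t • a)) w := fun x =>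
    (hp.differentiableAt_apply x u).hasFDerivAt.hasLineDerivAt a
  rwa [dirDeriv, hw.velocity_eq]

theorem dirDeriv_apply (hp : SmoothFamily p) (u a : V) (x : M) :
    dirDeriv p u a x = fderiv ℝ (fun u => p u x) u a :=
  (hp.hasVelocity_dirDeriv u a x).unique
    ((hp.differentiableAt_apply x u).hasFDerivAt.hasLineDerivAt a)

theorem dirDeriv (hp : SmoothFamily p) (a : V) : SmoothFamily fun u => dirDeriv p u a := by
  simpa only [SmoothFamily, hp.dirDeriv_apply] using contMDiff_fderiv_slice_apply hp a

theorem dirDeriv_mul (hp : SmoothFamily p) (hq : SmoothFamily q) (u a : V) :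
    HopfCole.dirDeriv (fun u => p u * q u) u a =
      HopfCole.dirDeriv p u a * q u + p u * HopfCole.dirDeriv q u a := by
  refine HasVelocity.velocity_eq fun x => ?_
  have h := (hp.hasVelocity_dirDeriv u a x).mul (hq.hasVelocity_dirDeriv u a x)
  simp only [zero_smul, add_zero] at h
  exact h

theorem dirDeriv_comm (hp : SmoothFamily p) (u a b : V) :
    HopfCole.dirDeriv (fun u => HopfCole.dirDeriv p u a) u b =
      HopfCole.dirDeriv (fun u => HopfCole.dirDeriv p u b) u a := by
  ext x
  have hd : DifferentiableAt ℝ (fderiv ℝ fun u => p u x) u :=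
    ((hp.contDiff_apply x).fderiv_right (m := ∞) (by simp)).differentiable (by simp) u
  have hsymm : IsSymmSndFDerivAt ℝ (fun u => p u x) u :=
    (hp.contDiff_apply x).contDiffAt.isSymmSndFDerivAt
      (by rw [minSmoothness_of_isRCLikeNormedField]; norm_cast)
  simp only [(hp.dirDeriv _).dirDeriv_apply, hp.dirDeriv_apply]
  rw [fderiv_clm_apply hd (differentiableAt_const a),
    fderiv_clm_apply hd (differentiableAt_const b)]
  simpa using hsymm b a

theorem hasVelocity {c : ℝ → SmoothFn d M} (hc : SmoothFamily c) :
    HasVelocity c (velocity c) := by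
  simpa [HopfCole.dirDeriv] using hc.hasVelocity_dirDeriv 0 1

theorem exists_eq_add_smul {c : ℝ → SmoothFn d M} (hc : SmoothFamily c) :
    ∃ w : ℝ → SmoothFn d M, SmoothFamily w ∧ ∀ t, c t = c 0 + t • w t := by
  obtain ⟨g, hg, h⟩ := exists_contMDiff_eq_add_smul hc
  exact ⟨fun t => ⟨fun x => g (t, x), hg.comp (contMDiff_const.prodMk contMDiff_id)⟩, hg,
    fun t => ContMDiffMap.ext fun x => h t x⟩

end SmoothFamily

namespace SmoothFamilyAt

variable [IsManifold (𝓡 d) ∞ M] {p : V → SmoothFn d M} {u : V}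

theorem hasVelocity_dirDeriv (hp : SmoothFamilyAt p u) (a : V) :
    HasVelocity (fun t : ℝ => p (u + t • a)) (dirDeriv p u a) := by
  obtain ⟨q, hq, hpq⟩ := hp
  have h := (hq.hasVelocity_dirDeriv u a).congr (eventually_add_smul hpq a)
  rwa [dirDeriv, h.velocity_eq]

theorem dirDeriv_apply (hp : SmoothFamilyAt p u) (a : V) (x : M) :
    dirDeriv p u a x = fderiv ℝ (fun u => p u x) u a := by
  obtain ⟨q, hq, hpq⟩ := hp
  have hx : (fun u => p u x) =ᶠ[𝓝 u] fun u => q u x := hpq.mono fun y hy => by simp only [hy]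
  have h := (hq.hasVelocity_dirDeriv u a).congr (eventually_add_smul hpq a)
  rw [dirDeriv, h.velocity_eq, hq.dirDeriv_apply, hx.fderiv_eq]

theorem dirDeriv_add (hp : SmoothFamilyAt p u) (a b : V) :
    dirDeriv p u (a + b) = dirDeriv p u a + dirDeriv p u b := by
  ext x
  simp only [hp.dirDeriv_apply, map_add, ContMDiffMap.coe_add, Pi.add_apply]

theorem dirDeriv_smul (hp : SmoothFamilyAt p u) (r : ℝ) (a : V) :
    dirDeriv p u (r • a) = r • dirDeriv p u a := by
  ext x
  simp only [hp.dirDeriv_apply, map_smul, ContMDiffMap.coe_smul, Pi.smul_apply]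

end SmoothFamilyAt

end SmoothFamily

section SmoothOperator

variable {d : ℕ} {M : Type*} [TopologicalSpace M] [ChartedSpace (EuclideanSpace ℝ (Fin d)) M]

theorem smoothFamily_line (f v : SmoothFn d M) : SmoothFamily fun t : ℝ => f + t • v :=
  (SmoothFamily.const f).add ((SmoothFamily.const v).smul contDiff_id)

theorem smoothFamily_plane (f v w : SmoothFn d M) :
    SmoothFamily fun z : ℝ × ℝ => f + z.1 • v + z.2 • w :=
  ((smoothFamily_line f v).comp contDiff_fst).add ((SmoothFamily.const w).smul contDiff_snd)

theorem dirDeriv_plane (G : SmoothFn d M → SmoothFn d M) (f v w : SmoothFn d M) (a : ℝ × ℝ) :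
    dirDeriv (fun z : ℝ × ℝ => G (f + z.1 • v + z.2 • w)) 0 a =
      dirDeriv G f (a.1 • v + a.2 • w) := by
  simp [dirDeriv, smul_smul, add_assoc]

/-- `G` is a smooth map from the open set `D` of `C^∞(M)` to `C^∞(M)`. -/
structure IsSmoothOn (G : SmoothFn d M → SmoothFn d M) (D : Set (SmoothFn d M)) : Prop where
  isOpen : IsOpen[dTopology] D
  dSmooth : DSmooth fun η : D => G η

namespace IsSmoothOn

variable {G : SmoothFn d M → SmoothFn d M} {D : Set (SmoothFn d M)}

section

variable {V : Type*} [NormedAddCommGroup V] [NormedSpace ℝ V] [FiniteDimensional ℝ V]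
  {p : V → SmoothFn d M}

theorem smoothFamily_comp (hG : IsSmoothOn G D) (hp : SmoothFamily p) (hD : ∀ u, p u ∈ D) :
    SmoothFamily fun u => G (p u) :=
  .of_comp_toEuclidean_symm <|
    hG.dSmooth _ (fun u => ⟨p ((toEuclidean (E := V)).symm u), hD _⟩)
      (hp.comp (toEuclidean (E := V)).symm.contDiff)

theorem smoothFamilyAt_comp (hG : IsSmoothOn G D) {u : V} (hp : SmoothFamilyAt p u)
    (hu : p u ∈ D) : SmoothFamilyAt (fun u => G (p u)) u := by
  obtain ⟨q, hq, hpq⟩ := hp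
  have hqu : q ⁻¹' D ∈ 𝓝 u := (hq.isOpen_preimage hG.isOpen).mem_nhds (by
    rwa [Set.mem_preimage, ← hpq.self_of_nhds])
  obtain ⟨φ, hφ, hφD, hφu⟩ := exists_contDiff_eventuallyEq_id hqu
  refine ⟨fun y => G (q (φ y)), hG.smoothFamily_comp (hq.comp hφ) hφD, ?_⟩
  filter_upwards [hpq, hφu] with y hpy hφy
  rw [hpy, hφy, id]

end

theorem eventually_line_mem (hG : IsSmoothOn G D) {f : SmoothFn d M} (hf : f ∈ D)
    (v : SmoothFn d M) : ∀ᶠ t : ℝ in 𝓝 0, f + t • v ∈ D :=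
  ((smoothFamily_line f v).isOpen_preimage hG.isOpen).mem_nhds (by simpa using hf)

theorem smoothFamilyAt_plane (hG : IsSmoothOn G D) {f : SmoothFn d M} (hf : f ∈ D)
    (v w : SmoothFn d M) : SmoothFamilyAt (fun z : ℝ × ℝ => G (f + z.1 • v + z.2 • w)) 0 :=
  hG.smoothFamilyAt_comp ((smoothFamily_plane f v w).smoothFamilyAt 0) (by simpa using hf)

variable [IsManifold (𝓡 d) ∞ M]

theorem hasVelocity_comp (hG : IsSmoothOn G D) {c : ℝ → SmoothFn d M} (hc : SmoothFamilyAt c 0)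
    (hD : c 0 ∈ D) {v : SmoothFn d M} (hv : HasVelocity c v) :
    HasVelocity (fun t => G (c t)) (dirDeriv G (c 0) v) := by
  obtain ⟨q, hq, hcq⟩ := hc
  obtain ⟨w, hw, hqw⟩ := hq.exists_eq_add_smul
  have hc₀ : c 0 = q 0 := hcq.self_of_nhds
  have hc_eq : c =ᶠ[𝓝 0] fun t => q 0 + t • w t := hcq.trans (.of_forall hqw)
  have hwv : w 0 = v := ((hw.hasVelocity_add_smul (q 0)).congr hc_eq).unique hv
  -- `t ↦ G (c t)` is the diagonal of the two-parameter family `P`, whose derivative is additive.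
  let P : ℝ × ℝ → SmoothFn d M := fun z => G (q 0 + z.1 • w z.2)
  have hP : SmoothFamilyAt P 0 := by
    refine hG.smoothFamilyAt_comp (SmoothFamily.smoothFamilyAt ?_ _) ?_
    · exact (SmoothFamily.const _).add ((hw.comp contDiff_snd).smul contDiff_fst)
    · simpa [← hc₀] using hD
  have hdiag := hP.hasVelocity_dirDeriv (1, 1)
  have h₁ : dirDeriv P 0 (1, 0) = dirDeriv G (c 0) v := by simp [dirDeriv, P, hwv, hc₀]
  have h₂ : dirDeriv P 0 (0, 1) = 0 := by
    simpa [dirDeriv, P] using (hasVelocity_const (G (q 0))).velocity_eq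
  rw [show ((1, 1) : ℝ × ℝ) = (1, 0) + (0, 1) by simp, hP.dirDeriv_add, h₁, h₂, add_zero] at hdiag
  refine hdiag.congr (hc_eq.mono fun t ht => ?_)
  simp [P, ht]

theorem dirDeriv_add (hG : IsSmoothOn G D) {f : SmoothFn d M} (hf : f ∈ D) (v w : SmoothFn d M) :
    dirDeriv G f (v + w) = dirDeriv G f v + dirDeriv G f w := by
  simpa [dirDeriv_plane] using (hG.smoothFamilyAt_plane hf v w).dirDeriv_add (1, 0) (0, 1)

theorem dirDeriv_smul (hG : IsSmoothOn G D) {f : SmoothFn d M} (hf : f ∈ D) (r : ℝ)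
    (v : SmoothFn d M) : dirDeriv G f (r • v) = r • dirDeriv G f v := by
  simpa only [dirDeriv_plane, Prod.smul_mk, smul_eq_mul, mul_one, mul_zero, one_smul, zero_smul,
    add_zero] using (hG.smoothFamilyAt_plane hf v 0).dirDeriv_smul r (1, 0)

theorem dirDeriv_dirDeriv_of_leftInvOn (hG : IsSmoothOn G D) {G' : SmoothFn d M → SmoothFn d M}
    {D' : Set (SmoothFn d M)} (hG' : IsSmoothOn G' D') (hmaps : Set.MapsTo G D D')
    (hinv : Set.LeftInvOn G' G D) {f : SmoothFn d M} (hf : f ∈ D) (v : SmoothFn d M) :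
    dirDeriv G' (G f) (dirDeriv G f v) = v := by
  have hf₀ : f + (0 : ℝ) • v = f := by simp
  have hline : SmoothFamilyAt (fun t : ℝ => f + t • v) 0 :=
    (smoothFamily_line f v).smoothFamilyAt 0
  have hGline : SmoothFamilyAt (fun t : ℝ => G (f + t • v)) 0 :=
    hG.smoothFamilyAt_comp hline (by rwa [hf₀])
  have hvel : HasVelocity (fun t : ℝ => G (f + t • v)) (dirDeriv G f v) := by
    simpa only [hf₀] using hG.hasVelocity_comp hline (by rwa [hf₀]) (hasVelocity_add_smul_const f v)
  have hvel' := hG'.hasVelocity_comp hGline (by simpa only [hf₀] using hmaps hf) hvel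
  rw [hf₀] at hvel'
  refine hvel'.unique ((hasVelocity_add_smul_const f v).congr ?_)
  filter_upwards [hG.eventually_line_mem hf v] with t ht using hinv ht

end IsSmoothOn

end SmoothOperator

section L2Form

variable {d : ℕ} {M : Type*} [TopologicalSpace M] [CompactSpace M]
  [ChartedSpace (EuclideanSpace ℝ (Fin d)) M] [MeasurableSpace M] [OpensMeasurableSpace M]
  (μ : Measure M) [IsFiniteMeasure μ]

theorem integrable_smoothFn (f : SmoothFn d M) : Integrable f μ :=
  f.contMDiff.continuous.integrable_of_hasCompactSupport (HasCompactSupport.of_compactSpace f)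

/-- The `L²` inner product of smooth functions, as a bilinear form. -/
noncomputable def l2Form : LinearMap.BilinForm ℝ (SmoothFn d M) :=
  LinearMap.mk₂ ℝ (fun f g => ∫ x, f x * g x ∂μ)
    (fun f f' g => by
      simpa only [ContMDiffMap.coe_add, ContMDiffMap.coe_mul, Pi.add_apply, Pi.mul_apply,
        add_mul] using integral_add (integrable_smoothFn μ (f * g))
          (integrable_smoothFn μ (f' * g)))
    (fun r f g => by
      simpa only [ContMDiffMap.coe_smul, Pi.smul_apply, smul_eq_mul, mul_assoc] using
        integral_const_mul r fun x => f x * g x)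
    (fun f g g' => by
      simpa only [ContMDiffMap.coe_add, ContMDiffMap.coe_mul, Pi.add_apply, Pi.mul_apply,
        mul_add] using integral_add (integrable_smoothFn μ (f * g))
          (integrable_smoothFn μ (f * g')))
    (fun r f g => by
      simpa only [ContMDiffMap.coe_smul, Pi.smul_apply, smul_eq_mul, mul_left_comm] using
        integral_const_mul r fun x => f x * g x)

theorem l2Form_apply (f g : SmoothFn d M) : l2Form μ f g = ∫ x, f x * g x ∂μ :=
  rfl

theorem l2Form_one_left (f : SmoothFn d M) : l2Form μ 1 f = ∫ x, f x ∂μ := by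
  simp [l2Form_apply]

theorem l2Form_comm (f g : SmoothFn d M) : l2Form μ f g = l2Form μ g f := by
  simp only [l2Form_apply, mul_comm]

theorem integral_mul_sub_mul (f g h k : SmoothFn d M) :
    ∫ x, (f x * g x - h x * k x) ∂μ = l2Form μ f g - l2Form μ h k :=
  integral_sub (integrable_smoothFn μ (f * g)) (integrable_smoothFn μ (h * k))

section OpenPos

variable {μ} [μ.IsOpenPosMeasure] {f : SmoothFn d M}

theorem eq_zero_of_l2Form_self (hf : l2Form μ f f = 0) : f = 0 := by
  have hcont : Continuous fun x => f x * f x :=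
    f.contMDiff.continuous.mul f.contMDiff.continuous
  ext x
  by_contra hx
  exact (integral_pos_of_integrable_nonneg_nonzero (μ := μ) (x := x) hcont
    (integrable_smoothFn μ (f * f)) (fun y => mul_self_nonneg (f y))
    (mul_self_ne_zero.2 hx)).ne' hf

theorem exists_eq_smul_one_of_l2Form_eq_zero
    (hf : ∀ r : SmoothFn d M, l2Form μ 1 r = 0 → l2Form μ f r = 0) :
    ∃ m : ℝ, f = m • (1 : SmoothFn d M) := by
  by_cases h₁ : l2Form μ (1 : SmoothFn d M) 1 = 0
  · refine ⟨0, ?_⟩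
    rw [← mul_one f, eq_zero_of_l2Form_self h₁, mul_zero, smul_zero]
  let m := l2Form μ 1 f / l2Form μ (1 : SmoothFn d M) 1
  let r := f - m • (1 : SmoothFn d M)
  have hr : l2Form μ 1 r = 0 := by simp [r, m, h₁]
  have hrr : l2Form μ r r = 0 := by
    rw [show l2Form μ r r = l2Form μ f r - m * l2Form μ 1 r by simp [r], hf r hr, hr]
    simp
  exact ⟨m, sub_eq_zero.1 (eq_zero_of_l2Form_self hrr)⟩

end OpenPos

variable {V : Type*} [NormedAddCommGroup V] [NormedSpace ℝ V] [FiniteDimensional ℝ V]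
  [IsManifold (𝓡 d) ∞ M]

namespace SmoothFamily

variable {p q : V → SmoothFn d M}

theorem contDiff_integral (hp : SmoothFamily p) : ContDiff ℝ ∞ fun u => ∫ x, p u x ∂μ := by
  simpa using contDiff_setIntegral_slice (μ := μ) isCompact_univ .univ hp

theorem fderiv_integral (hp : SmoothFamily p) (u a : V) :
    fderiv ℝ (fun u => ∫ x, p u x ∂μ) u a = ∫ x, HopfCole.dirDeriv p u a x ∂μ := by
  simpa only [Measure.restrict_univ, hp.dirDeriv_apply] using
    fderiv_setIntegral_slice_apply (μ := μ) isCompact_univ .univ hp u a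

theorem contDiff_l2Form (hp : SmoothFamily p) (hq : SmoothFamily q) :
    ContDiff ℝ ∞ fun u => l2Form μ (p u) (q u) :=
  (hp.mul hq).contDiff_integral μ

theorem fderiv_l2Form (hp : SmoothFamily p) (hq : SmoothFamily q) (u a : V) :
    fderiv ℝ (fun u => l2Form μ (p u) (q u)) u a =
      l2Form μ (HopfCole.dirDeriv p u a) (q u) + l2Form μ (p u) (HopfCole.dirDeriv q u a) := by
  refine ((hp.mul hq).fderiv_integral μ u a).trans ?_
  rw [hp.dirDeriv_mul hq]
  exact integral_add (integrable_smoothFn μ _) (integrable_smoothFn μ _)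

end SmoothFamily

namespace SmoothFamilyAt

variable {p : V → SmoothFn d M} {u : V}

theorem contDiffAt_l2Form (hp : SmoothFamilyAt p u) (g : SmoothFn d M) :
    ContDiffAt ℝ ∞ (fun u => l2Form μ (p u) g) u := by
  obtain ⟨q, hq, hpq⟩ := hp
  exact (hq.contDiff_l2Form μ (.const g)).contDiffAt.congr_of_eventuallyEq
    (hpq.mono fun y hy => by simp only [hy])

theorem fderiv_l2Form (hp : SmoothFamilyAt p u) (g : SmoothFn d M) (a : V) :
    fderiv ℝ (fun u => l2Form μ (p u) g) u a = l2Form μ (dirDeriv p u a) g := by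
  obtain ⟨q, hq, hpq⟩ := hp
  have hg : dirDeriv (fun _ : V => g) u a = 0 := (hasVelocity_const g).velocity_eq
  have hpq' : (fun u => l2Form μ (p u) g) =ᶠ[𝓝 u] fun u => l2Form μ (q u) g :=
    hpq.mono fun y hy => by simp only [hy]
  have hpq_deriv : dirDeriv p u a = dirDeriv q u a :=
    ((hq.hasVelocity_dirDeriv u a).congr (eventually_add_smul hpq a)).velocity_eq
  rw [hpq'.fderiv_eq, hq.fderiv_l2Form μ (.const g), hg, map_zero, add_zero, hpq_deriv]

end SmoothFamilyAt

end L2Form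

namespace InvertiblePotential

variable {d : ℕ} {M : Type*} [TopologicalSpace M] [ChartedSpace (EuclideanSpace ℝ (Fin d)) M]
  [MeasurableSpace M] {μ : Measure M} (Φ : InvertiblePotential d μ)

theorem δFinv_mem (f : SmoothFn d M) : Φ.δFinv f ∈ Φ.dom :=
  Φ.bijOn_δF.surjOn.mapsTo_invFunOn (Set.mem_univ f)

theorem isSmoothOn_δF : IsSmoothOn Φ.δF Φ.dom :=
  ⟨Φ.isOpen_dom, Φ.smooth_δF⟩

theorem isSmoothOn_δFinv : IsSmoothOn Φ.δFinv Set.univ :=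
  ⟨@isOpen_univ _ dTopology, fun n p hp => Φ.smooth_inv n (fun u => p u) hp⟩

theorem hasDerivAt_F_line {f v : SmoothFn d M} {t : ℝ} (h : f + t • v ∈ Φ.dom) :
    HasDerivAt (fun s : ℝ => Φ.F (f + s • v)) (∫ x, Φ.δF (f + t • v) x * v x ∂μ) t := by
  have h' := Φ.isFirstVariation _ h v
  rw [← sub_self t] at h'
  simpa only [add_assoc, ← add_smul, add_sub_cancel] using h'.comp_sub_const t t

variable [IsManifold (𝓡 d) ∞ M]

/-- The second variation `δ²F(η)` as a linear automorphism of `C^∞(M)`. Its inverse is the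
derivative of `(δF)⁻¹` at `δF(η)`. -/
noncomputable def hessian {η : SmoothFn d M} (hη : η ∈ Φ.dom) :
    SmoothFn d M ≃ₗ[ℝ] SmoothFn d M where
  toFun := Φ.secondVariation η
  invFun := dirDeriv Φ.δFinv (Φ.δF η)
  map_add' := Φ.isSmoothOn_δF.dirDeriv_add hη
  map_smul' := Φ.isSmoothOn_δF.dirDeriv_smul hη
  left_inv := Φ.isSmoothOn_δF.dirDeriv_dirDeriv_of_leftInvOn Φ.isSmoothOn_δFinv
    (Set.mapsTo_univ _ _) (fun _ => Φ.δFinv_δF) hη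
  right_inv w := by
    have h := Φ.isSmoothOn_δFinv.dirDeriv_dirDeriv_of_leftInvOn Φ.isSmoothOn_δF
      (fun f _ => Φ.δFinv_mem f) (fun f _ => Φ.δF_δFinv f) (Set.mem_univ (Φ.δF η)) w
    rwa [Φ.δFinv_δF hη] at h

theorem coe_hessian {η : SmoothFn d M} (hη : η ∈ Φ.dom) :
    ⇑(Φ.hessian hη) = Φ.secondVariation η :=
  rfl

theorem coe_hessian_symm {η : SmoothFn d M} (hη : η ∈ Φ.dom) :
    ⇑(Φ.hessian hη).symm = dirDeriv Φ.δFinv (Φ.δF η) :=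
  rfl

theorem invFun_secondVariation {η : SmoothFn d M} (hη : η ∈ Φ.dom) :
    Function.invFun (Φ.secondVariation η) = (Φ.hessian hη).symm :=
  Function.invFun_eq_of_injective_of_rightInverse (Φ.hessian hη).injective
    (Φ.hessian hη).apply_symm_apply

theorem hasVelocity_δF_comp {c : ℝ → SmoothFn d M} (hc : SmoothFamily c) (hD : c 0 ∈ Φ.dom) :
    HasVelocity (fun t => Φ.δF (c t)) (Φ.hessian hD (velocity c)) :=
  Φ.isSmoothOn_δF.hasVelocity_comp (hc.smoothFamilyAt 0) hD hc.hasVelocity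

/-- `σ(η, η^*)` as a linear automorphism of `C^∞(M)`. -/
noncomputable def sigmaEquiv {z : SmoothFn d M × SmoothFn d M} (h₁ : z.1 ∈ Φ.dom)
    (h₂ : z.2 ∈ Φ.dom) : SmoothFn d M ≃ₗ[ℝ] SmoothFn d M :=
  (Φ.hessian h₂).symm ≪≫ₗ Φ.hessian (Φ.δFinv_mem (Φ.δF z.1 + Φ.δF z.2)) ≪≫ₗ
    (Φ.hessian h₁).symm ≪≫ₗ LinearEquiv.smulOfNeZero ℝ _ (-(1 / 2)) (by norm_num)

theorem coe_sigmaEquiv {z : SmoothFn d M × SmoothFn d M} (h₁ : z.1 ∈ Φ.dom) (h₂ : z.2 ∈ Φ.dom) :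
    ⇑(Φ.sigmaEquiv h₁ h₂) = Φ.sigma z := by
  funext α
  simp only [sigma, invFun_secondVariation Φ h₁, invFun_secondVariation Φ h₂]
  rfl

theorem invFun_sigma_apply {z : SmoothFn d M × SmoothFn d M} (h₁ : z.1 ∈ Φ.dom)
    (h₂ : z.2 ∈ Φ.dom) (h : Φ.density z ∈ Φ.dom) (α : SmoothFn d M) :
    Function.invFun (Φ.sigma z) α =
      (-2 : ℝ) • Φ.hessian h₂ ((Φ.hessian h).symm (Φ.hessian h₁ α)) := by
  let e := Φ.sigmaEquiv h₁ h₂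
  have he : ⇑e = Φ.sigma z := Φ.coe_sigmaEquiv h₁ h₂
  rw [← he, Function.invFun_eq_of_injective_of_rightInverse e.injective e.apply_symm_apply,
    LinearEquiv.symm_apply_eq, he]
  simp [sigma, invFun_secondVariation Φ h₁, invFun_secondVariation Φ h₂, ← coe_hessian Φ h,
    smul_smul]

section Symmetry

variable [CompactSpace M] [OpensMeasurableSpace M] [IsFiniteMeasure μ]

theorem l2Form_hessian_left {η : SmoothFn d M} (hη : η ∈ Φ.dom) (v w : SmoothFn d M) :
    l2Form μ (Φ.hessian hη v) w = l2Form μ v (Φ.hessian hη w) := by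
  let p : ℝ × ℝ → SmoothFn d M := fun z => η + z.1 • v + z.2 • w
  have hdom : ∀ᶠ z in 𝓝 0, p z ∈ Φ.dom :=
    ((smoothFamily_plane η v w).isOpen_preimage Φ.isOpen_dom).mem_nhds (by simpa [p] using hη)
  have hδF : SmoothFamilyAt (fun z => Φ.δF (p z)) 0 := Φ.isSmoothOn_δF.smoothFamilyAt_plane hη v w
  have h₁ : ∀ᶠ z in 𝓝 0, HasDerivAt (fun s => Φ.F (p (s, z.2))) (l2Form μ (Φ.δF (p z)) v) z.1 := by
    filter_upwards [hdom] with z hz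
    simp only [p, add_right_comm η _ (z.2 • w)] at hz ⊢
    exact Φ.hasDerivAt_F_line hz
  have h₂ : ∀ᶠ z in 𝓝 0, HasDerivAt (fun t => Φ.F (p (z.1, t))) (l2Form μ (Φ.δF (p z)) w) z.2 :=
    hdom.mono fun z hz => Φ.hasDerivAt_F_line hz
  -- Schwarz's theorem for `(s, t) ↦ F(η + s v + t w)`, whose partial derivatives are given by `δF`.
  have hsymm := fderiv_partialDeriv_comm (f := fun z => Φ.F (p z)) h₁ h₂
    ((hδF.contDiffAt_l2Form μ v).of_le (by norm_cast))
    ((hδF.contDiffAt_l2Form μ w).of_le (by norm_cast))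
  rw [hδF.fderiv_l2Form μ v, hδF.fderiv_l2Form μ w, dirDeriv_plane, dirDeriv_plane] at hsymm
  simp only [zero_smul, one_smul, zero_add, add_zero] at hsymm
  exact hsymm.symm.trans (l2Form_comm μ _ _)

theorem l2Form_hessian_symm_left {η : SmoothFn d M} (hη : η ∈ Φ.dom) (v w : SmoothFn d M) :
    l2Form μ ((Φ.hessian hη).symm v) w = l2Form μ v ((Φ.hessian hη).symm w) := by
  simpa using (Φ.l2Form_hessian_left hη ((Φ.hessian hη).symm v) ((Φ.hessian hη).symm w)).symm

end Symmetry

end InvertiblePotential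

section Diffeology

variable {X Y Z : Type*} [DiffeologicalSpace X] [DiffeologicalSpace Y] [DiffeologicalSpace Z]

theorem dSmooth_prod_iff {f : X → Y × Z} :
    DSmooth f ↔ (DSmooth fun x => (f x).1) ∧ DSmooth fun x => (f x).2 :=
  ⟨fun h => ⟨fun n p hp => (h n p hp).1, fun n p hp => (h n p hp).2⟩,
    fun h n p hp => ⟨h.1 n p hp, h.2 n p hp⟩⟩

theorem dSmooth_quotient_mk (r : Setoid Z) : DSmooth (Quotient.mk r) := fun _ p hp =>
  DiffeologicalSpace.isPlot_generatedFrom_of_mem ⟨p, hp, rfl⟩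

theorem dSmooth_of_comp_quotient_mk {r : Setoid Z} {f : Quotient r → Y}
    (hf : DSmooth fun z => f (Quotient.mk r z)) : DSmooth f := by
  -- The coarsest diffeology that makes `f` smooth contains the generators of the quotient one.
  let coarse : DiffeologicalSpace (Quotient r) :=
    { plots := fun n => {p | IsPlot (f ∘ p)}
      constant_plots := fun _ => isPlot_const
      plot_reparam := fun hp hg => isPlot_reparam hp hg
      locality := fun {n p} hp => DiffeologicalSpace.locality fun x => by
        obtain ⟨u, hu, hx, h⟩ := hp x
        exact ⟨u, hu, hx, fun {m g} hg hg' => h hg hg'⟩ }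
  intro n p hp
  refine hp coarse ?_
  rintro ⟨m, s⟩ ⟨q, hq, hs⟩
  have hs' : s = fun u => Quotient.mk r (q u) := hs
  change IsPlot (f ∘ s)
  rw [hs']
  exact hf m q hq

end Diffeology

section Carrier

variable {d : ℕ} {M : Type*} [TopologicalSpace M] [ChartedSpace (EuclideanSpace ℝ (Fin d)) M]

theorem dSmooth_iff_smoothFamily {c : ℝ → SmoothFn d M} : DSmooth c ↔ SmoothFamily c :=
  ⟨fun hc => .of_comp_toEuclidean_symm (hc _ _ (toEuclidean (E := ℝ)).symm.contDiff.isPlot),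
    fun hc _ _ hp => hc.comp hp.contDiff⟩

theorem dSmooth_carrier_iff {A : Set (SmoothFn d M × SmoothFn d M)} {c : ℝ → A} :
    DSmooth c ↔ (SmoothFamily fun t => (c t).1.1) ∧ SmoothFamily fun t => (c t).1.2 := by
  rw [← dSmooth_iff_smoothFamily, ← dSmooth_iff_smoothFamily]
  exact dSmooth_prod_iff (f := fun t => (c t : SmoothFn d M × SmoothFn d M))

theorem isPlot_carrier_iff {A : Set (SmoothFn d M × SmoothFn d M)} {n : ℕ}
    {p : EuclideanSpace ℝ (Fin n) → A} :
    IsPlot p ↔ (SmoothFamily fun u => (p u).1.1) ∧ SmoothFamily fun u => (p u).1.2 :=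
  Iff.rfl

theorem exists_velocity_eq_add_smul_one [IsManifold (𝓡 d) ∞ M] {c c' : ℝ → SmoothFn d M}
    (hc : SmoothFamily c) (hc' : SmoothFamily c') (h : ∀ t, ∃ k : ℝ, ∀ x, c' t x = c t x + k) :
    ∃ k : ℝ, velocity c' = velocity c + k • 1 := by
  choose k hk using h
  have hvel (x : M) : HasDerivAt k (velocity c' x - velocity c x) 0 :=
    ((hc'.hasVelocity x).sub (hc.hasVelocity x)).congr_of_eventuallyEq
      (.of_forall fun t => by simp [hk])
  refine ⟨deriv k 0, ContMDiffMap.ext fun x => ?_⟩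
  simp [(hvel x).deriv]

end Carrier

namespace PhaseSpace

variable {d : ℕ} {M : Type*} [TopologicalSpace M] [ChartedSpace (EuclideanSpace ℝ (Fin d)) M]

theorem vel_eq (A : PhaseSpace d M) {c : ℝ → A.carrier} {v w : SmoothFn d M}
    (hv : HasVelocity (fun t => (c t).1.1) v) (hw : HasVelocity (fun t => (c t).1.2) w) :
    A.vel c = (v, w) :=
  Prod.ext hv.velocity_eq hw.velocity_eq

/-- A diffeomorphism of phase spaces, given on representatives. It comes with its differential,
which is defined and invertible on all pairs of functions, not only on tangent vectors. -/
structure Diffeo (A B : PhaseSpace d M) where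
  toEquiv : A.carrier ≃ B.carrier
  dSmooth : DSmooth toEquiv
  dSmooth_symm : DSmooth toEquiv.symm
  rel_iff : ∀ z z', A.rel z z' ↔ B.rel (toEquiv z) (toEquiv z')
  differential : A.carrier →
    (SmoothFn d M × SmoothFn d M) ≃ₗ[ℝ] SmoothFn d M × SmoothFn d M
  vel_comp : ∀ c : ℝ → A.carrier, DSmooth c →
    B.vel (fun t => toEquiv (c t)) = differential (c 0) (A.vel c)

namespace Diffeo

variable {A B : PhaseSpace d M} (e : Diffeo A B)

theorem exists_lift {b : ℝ → B.carrier} (hb : DSmooth b) {z : A.carrier}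
    (hz : b 0 = e.toEquiv z) :
    ∃ c : ℝ → A.carrier, DSmooth c ∧ c 0 = z ∧ (∀ t, e.toEquiv (c t) = b t) ∧
      B.vel b = e.differential z (A.vel c) := by
  let c : ℝ → A.carrier := fun t => e.toEquiv.symm (b t)
  have hc : DSmooth c := e.dSmooth_symm.comp hb
  have hc₀ : c 0 = z := e.toEquiv.symm_apply_eq.2 hz
  have hcb (t : ℝ) : e.toEquiv (c t) = b t := e.toEquiv.apply_symm_apply (b t)
  refine ⟨c, hc, hc₀, hcb, ?_⟩
  rw [← hc₀, ← e.vel_comp c hc]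
  exact congrArg B.vel (funext fun t => (hcb t).symm)

theorem differential_mem_tangent_iff {z : A.carrier} {v : SmoothFn d M × SmoothFn d M} :
    e.differential z v ∈ B.tangent (e.toEquiv z) ↔ v ∈ A.tangent z := by
  constructor
  · rintro ⟨b, hb, hb₀, hbv⟩
    obtain ⟨c, hc, hc₀, -, hvel⟩ := e.exists_lift hb hb₀
    exact ⟨c, hc, hc₀, (e.differential z).injective (hvel.symm.trans hbv)⟩
  · rintro ⟨c, hc, rfl, rfl⟩
    exact ⟨fun t => e.toEquiv (c t), e.dSmooth.comp hc, rfl, e.vel_comp c hc⟩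

theorem mem_vertical_of_differential_mem {z : A.carrier} {v : SmoothFn d M × SmoothFn d M}
    (h : e.differential z v ∈ B.vertical (e.toEquiv z)) : v ∈ A.vertical z := by
  obtain ⟨b, hb, hb₀, hrel, hbv⟩ := h
  obtain ⟨c, hc, hc₀, hcb, hvel⟩ := e.exists_lift hb hb₀
  refine ⟨c, hc, hc₀, fun t => (e.rel_iff _ _).2 ?_,
    (e.differential z).injective (hvel.symm.trans hbv)⟩
  simpa only [← hcb t] using hrel t

theorem exists_equiv_point :
    ∃ E : A.Point ≃ B.Point, (∀ z, E (Quotient.mk A.rel z) = Quotient.mk B.rel (e.toEquiv z)) ∧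
      DSmooth E ∧ DSmooth E.symm :=
  ⟨Quotient.congr e.toEquiv e.rel_iff, fun _ => rfl,
    dSmooth_of_comp_quotient_mk ((dSmooth_quotient_mk _).comp e.dSmooth),
    dSmooth_of_comp_quotient_mk ((dSmooth_quotient_mk _).comp e.dSmooth_symm)⟩

variable {ΩA : A.carrier → SmoothFn d M × SmoothFn d M → SmoothFn d M × SmoothFn d M → ℝ}
  {ΩB : B.carrier → SmoothFn d M × SmoothFn d M → SmoothFn d M × SmoothFn d M → ℝ}
  (hΩ : ∀ z v w, ΩA z v w = ΩB (e.toEquiv z) (e.differential z v) (e.differential z w))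

include hΩ

theorem form_vel_comp {c₁ c₂ : ℝ → A.carrier} (hc₁ : DSmooth c₁) (hc₂ : DSmooth c₂)
    (h₀ : c₁ 0 = c₂ 0) :
    ΩB (e.toEquiv (c₁ 0)) (B.vel fun t => e.toEquiv (c₁ t)) (B.vel fun t => e.toEquiv (c₂ t)) =
      ΩA (c₁ 0) (A.vel c₁) (A.vel c₂) := by
  rw [hΩ, e.vel_comp c₁ hc₁, e.vel_comp c₂ hc₂, h₀]

theorem pullbackCoeff_comp {n : ℕ} {p : EuclideanSpace ℝ (Fin n) → A.carrier} (hp : IsPlot p)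
    (a b : EuclideanSpace ℝ (Fin n)) :
    B.pullbackCoeff ΩB (fun u => e.toEquiv (p u)) a b = A.pullbackCoeff ΩA p a b := by
  funext u
  have hline (a : EuclideanSpace ℝ (Fin n)) : DSmooth fun t : ℝ => p (u + t • a) :=
    hp.dSmooth.comp (ContDiff.dSmooth (by fun_prop))
  have h := e.form_vel_comp hΩ (hline a) (hline b) (by simp)
  simp only [zero_smul, add_zero] at h
  exact h

theorem isSymplecticForm (hB : B.IsSymplecticForm ΩB) : A.IsSymplecticForm ΩA where
  add_left z v hv v' hv' w hw := by
    simp only [hΩ, map_add]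
    exact hB.add_left _ _ (e.differential_mem_tangent_iff.2 hv) _
      (e.differential_mem_tangent_iff.2 hv') _ (e.differential_mem_tangent_iff.2 hw)
  smul_left z r v hv w hw := by
    simp only [hΩ, map_smul]
    exact hB.smul_left _ r _ (e.differential_mem_tangent_iff.2 hv) _
      (e.differential_mem_tangent_iff.2 hw)
  skew z v hv w hw := by
    simp only [hΩ]
    exact hB.skew _ _ (e.differential_mem_tangent_iff.2 hv) _
      (e.differential_mem_tangent_iff.2 hw)
  descends c₁ c₂ c₁' c₂' hc₁ hc₂ hc₁' hc₂' h h' hr₁ hr₂ := by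
    rw [← e.form_vel_comp hΩ hc₁ hc₂ h, ← e.form_vel_comp hΩ hc₁' hc₂' h']
    exact hB.descends _ _ _ _ (e.dSmooth.comp hc₁) (e.dSmooth.comp hc₂)
      (e.dSmooth.comp hc₁') (e.dSmooth.comp hc₂') (congrArg _ h) (congrArg _ h')
      (fun t => (e.rel_iff _ _).1 (hr₁ t)) fun t => (e.rel_iff _ _).1 (hr₂ t)
  nondegenerate z v hv h := by
    refine e.mem_vertical_of_differential_mem
      (hB.nondegenerate _ _ (e.differential_mem_tangent_iff.2 hv) fun w hw => ?_)
    obtain ⟨w, rfl⟩ := (e.differential z).surjective w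
    rw [← hΩ]
    exact h w (e.differential_mem_tangent_iff.1 hw)
  smooth n p hp a b := by
    rw [← e.pullbackCoeff_comp hΩ hp]
    exact hB.smooth n _ (e.dSmooth n p hp) a b
  closed n p hp a b c u := by
    simp only [← e.pullbackCoeff_comp hΩ hp]
    exact hB.closed n _ (e.dSmooth n p hp) a b c u

theorem isSymplectomorphism (hB : B.IsSymplecticForm ΩB) :
    A.IsSymplectomorphism B ΩA ΩB e.toEquiv where
  symplectic_source := e.isSymplecticForm hΩ hB
  symplectic_target := hB
  smooth := e.dSmooth
  diffeo := e.exists_equiv_point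
  pullback _ _ := e.form_vel_comp hΩ

end Diffeo

end PhaseSpace

section Wasserstein

variable {d : ℕ} {M : Type*} [TopologicalSpace M] [ChartedSpace (EuclideanSpace ℝ (Fin d)) M]

theorem exists_pos_abs_lt_mul [CompactSpace M] {ρ : SmoothFn d M} (hρ : ∀ x, 0 < ρ x)
    (r : SmoothFn d M) : ∃ C > 0, ∀ x, |r x| < C * ρ x := by
  have hcont : Continuous fun x => r x / ρ x :=
    r.contMDiff.continuous.div₀ ρ.contMDiff.continuous fun x => (hρ x).ne'
  obtain ⟨C, hC⟩ := isCompact_univ.exists_bound_of_continuousOn hcont.continuousOn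
  refine ⟨|C| + 1, by positivity, fun x => ?_⟩
  have hx : |r x / ρ x| < |C| + 1 :=
    (hC x trivial).trans_lt ((le_abs_self C).trans_lt (lt_add_one _))
  rwa [abs_div, abs_of_pos (hρ x), div_lt_iff₀ (hρ x)] at hx

variable [MeasurableSpace M] {μ : Measure M}

theorem smul_one_mem_vertical_cotangentBundle (z : (cotangentBundle (d := d) μ).carrier) (m : ℝ) :
    (0, m • (1 : SmoothFn d M)) ∈ (cotangentBundle μ).vertical z :=
  ⟨fun t => ⟨(z.1.1, z.1.2 + t • m • 1), z.2⟩,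
    dSmooth_carrier_iff.2 ⟨.const _, smoothFamily_line _ _⟩,
    Subtype.ext (Prod.ext rfl (by simp)), fun t => ⟨rfl, -(t * m), fun x => by simp⟩,
    PhaseSpace.vel_eq _ (hasVelocity_const _) (hasVelocity_add_smul_const _ _)⟩

variable [CompactSpace M] [OpensMeasurableSpace M] [IsFiniteMeasure μ]

theorem exists_curve_in_densities {ρ r : SmoothFn d M} (hρ : ρ ∈ densities μ)
    (hr : l2Form μ 1 r = 0) :
    ∃ c : ℝ → SmoothFn d M, SmoothFamily c ∧ c 0 = ρ ∧ HasVelocity c r ∧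
      ∀ t, c t ∈ densities μ := by
  obtain ⟨C, hC, hrC⟩ := exists_pos_abs_lt_mul hρ.1 r
  -- The bounded reparametrization `t ↦ sin (C t) / C` keeps the line through `ρ` positive.
  let φ : ℝ → ℝ := fun t => Real.sin (C * t) / C
  have hφ (t : ℝ) : |φ t| ≤ C⁻¹ := by
    rw [abs_div, abs_of_pos hC, div_eq_mul_inv]
    exact mul_le_of_le_one_left (inv_nonneg.2 hC.le) (Real.abs_sin_le_one _)
  have hφ_smooth : ContDiff ℝ ∞ φ :=
    (Real.contDiff_sin.comp (contDiff_const.mul contDiff_id)).div_const C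
  have hφ' : HasDerivAt φ 1 0 := by
    simpa [hC.ne'] using ((hasDerivAt_id (0 : ℝ)).const_mul C).sin.div_const C
  refine ⟨fun t => ρ + φ t • r, (SmoothFamily.const ρ).add (.smul hφ_smooth (.const r)),
    by simp [φ], fun x => by simpa using (hφ'.mul_const (r x)).const_add (ρ x),
    fun t => ⟨fun x => ?_, ?_⟩⟩
  · have hx : |φ t * r x| < ρ x := by
      calc |φ t * r x| ≤ C⁻¹ * |r x| := by
            rw [abs_mul]
            exact mul_le_mul_of_nonneg_right (hφ t) (abs_nonneg _)
        _ < C⁻¹ * (C * ρ x) := mul_lt_mul_of_pos_left (hrC x) (inv_pos.2 hC)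
        _ = ρ x := inv_mul_cancel_left₀ hC.ne' _
    exact neg_lt_iff_pos_add'.1 (abs_lt.1 hx).1
  · rw [← l2Form_one_left, map_add, map_smul, hr, smul_zero, add_zero, l2Form_one_left]
    exact hρ.2

theorem wassersteinForm_eq (z : (cotangentBundle (d := d) μ).carrier)
    (v w : SmoothFn d M × SmoothFn d M) :
    wassersteinForm μ z v w = l2Form μ v.1 w.2 - l2Form μ w.1 v.2 :=
  integral_mul_sub_mul μ v.1 w.2 w.1 v.2

theorem pullbackCoeff_wassersteinForm {n : ℕ}
    (p : EuclideanSpace ℝ (Fin n) → (cotangentBundle (d := d) μ).carrier)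
    (a b u : EuclideanSpace ℝ (Fin n)) :
    (cotangentBundle μ).pullbackCoeff (wassersteinForm μ) p a b u =
      l2Form μ (dirDeriv (fun u => (p u).1.1) u a) (dirDeriv (fun u => (p u).1.2) u b) -
        l2Form μ (dirDeriv (fun u => (p u).1.1) u b) (dirDeriv (fun u => (p u).1.2) u a) :=
  wassersteinForm_eq _ _ _

variable [IsManifold (𝓡 d) ∞ M]

theorem l2Form_one_velocity_eq_zero {c : ℝ → SmoothFn d M} (hc : SmoothFamily c)
    (h : ∀ t, c t ∈ densities μ) : l2Form μ 1 (velocity c) = 0 := by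
  have hderiv := hc.fderiv_integral μ 0 1
  simp only [fun t => (h t).2, fderiv_fun_const, dirDeriv, zero_add, smul_eq_mul, mul_one] at hderiv
  rw [l2Form_one_left, ← hderiv]
  simp

theorem mem_tangent_cotangentBundle_iff {z : (cotangentBundle (d := d) μ).carrier}
    {v : SmoothFn d M × SmoothFn d M} :
    v ∈ (cotangentBundle μ).tangent z ↔ l2Form μ 1 v.1 = 0 := by
  constructor
  · rintro ⟨c, hc, -, rfl⟩
    exact l2Form_one_velocity_eq_zero (dSmooth_carrier_iff.1 hc).1 fun t => (c t).2
  · intro hv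
    obtain ⟨c, hc, hc₀, hcv, hmem⟩ := exists_curve_in_densities z.2 hv
    exact ⟨fun t => ⟨(c t, z.1.2 + t • v.2), hmem t⟩,
      dSmooth_carrier_iff.2 ⟨hc, smoothFamily_line _ _⟩, Subtype.ext (Prod.ext hc₀ (by simp)),
      PhaseSpace.vel_eq _ hcv (hasVelocity_add_smul_const _ _)⟩

theorem wassersteinForm_descends {c₁ c₂ c₁' c₂' : ℝ → (cotangentBundle (d := d) μ).carrier}
    (hc₁ : DSmooth c₁) (hc₂ : DSmooth c₂) (hc₁' : DSmooth c₁') (hc₂' : DSmooth c₂')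
    (hr₁ : ∀ t, (cotangentBundle μ).rel (c₁ t) (c₁' t))
    (hr₂ : ∀ t, (cotangentBundle μ).rel (c₂ t) (c₂' t)) :
    wassersteinForm μ (c₁ 0) ((cotangentBundle μ).vel c₁) ((cotangentBundle μ).vel c₂) =
      wassersteinForm μ (c₁' 0) ((cotangentBundle μ).vel c₁') ((cotangentBundle μ).vel c₂') := by
  rw [dSmooth_carrier_iff] at hc₁ hc₂ hc₁' hc₂'
  have hρ₁ : (fun t => (c₁' t).1.1) = fun t => (c₁ t).1.1 := funext fun t => (hr₁ t).1.symm
  have hρ₂ : (fun t => (c₂' t).1.1) = fun t => (c₂ t).1.1 := funext fun t => (hr₂ t).1.symm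
  obtain ⟨k₁, hk₁⟩ := exists_velocity_eq_add_smul_one hc₁.2 hc₁'.2 fun t => (hr₁ t).2
  obtain ⟨k₂, hk₂⟩ := exists_velocity_eq_add_smul_one hc₂.2 hc₂'.2 fun t => (hr₂ t).2
  simp only [wassersteinForm_eq, PhaseSpace.vel, velocityPair, hρ₁, hρ₂, hk₁, hk₂, map_add,
    map_smul, l2Form_comm μ _ 1, l2Form_one_velocity_eq_zero hc₁.1 fun t => (c₁ t).2,
    l2Form_one_velocity_eq_zero hc₂.1 fun t => (c₂ t).2, smul_zero, add_zero]

theorem mem_vertical_of_wassersteinForm_eq_zero [μ.IsOpenPosMeasure]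
    {z : (cotangentBundle (d := d) μ).carrier} {v : SmoothFn d M × SmoothFn d M}
    (h : ∀ w ∈ (cotangentBundle μ).tangent z, wassersteinForm μ z v w = 0) :
    v ∈ (cotangentBundle μ).vertical z := by
  simp only [mem_tangent_cotangentBundle_iff, wassersteinForm_eq] at h
  obtain ⟨ρ', S'⟩ := v
  obtain rfl : ρ' = 0 := eq_zero_of_l2Form_self (μ := μ) (by simpa using h (0, ρ') (by simp))
  obtain ⟨m, rfl⟩ : ∃ m : ℝ, S' = m • (1 : SmoothFn d M) :=
    exists_eq_smul_one_of_l2Form_eq_zero fun r hr => by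
      simpa [l2Form_comm μ r] using h (r, 0) hr
  exact smul_one_mem_vertical_cotangentBundle z m

theorem contDiff_pullbackCoeff_wassersteinForm {n : ℕ}
    {p : EuclideanSpace ℝ (Fin n) → (cotangentBundle (d := d) μ).carrier} (hp : IsPlot p)
    (a b : EuclideanSpace ℝ (Fin n)) :
    ContDiff ℝ ∞ ((cotangentBundle μ).pullbackCoeff (wassersteinForm μ) p a b) := by
  obtain ⟨hρ, hS⟩ := isPlot_carrier_iff.1 hp
  rw [funext (pullbackCoeff_wassersteinForm p a b)]
  exact ((hρ.dirDeriv a).contDiff_l2Form μ (hS.dirDeriv b)).sub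
    ((hρ.dirDeriv b).contDiff_l2Form μ (hS.dirDeriv a))

theorem fderiv_pullbackCoeff_wassersteinForm {n : ℕ}
    {p : EuclideanSpace ℝ (Fin n) → (cotangentBundle (d := d) μ).carrier} (hp : IsPlot p)
    (a b c u : EuclideanSpace ℝ (Fin n)) :
    fderiv ℝ ((cotangentBundle μ).pullbackCoeff (wassersteinForm μ) p a b) u c =
      let ρ := fun u => (p u).1.1
      let S := fun u => (p u).1.2
      l2Form μ (dirDeriv (fun u => dirDeriv ρ u a) u c) (dirDeriv S u b) +
          l2Form μ (dirDeriv ρ u a) (dirDeriv (fun u => dirDeriv S u b) u c) -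
        (l2Form μ (dirDeriv (fun u => dirDeriv ρ u b) u c) (dirDeriv S u a) +
          l2Form μ (dirDeriv ρ u b) (dirDeriv (fun u => dirDeriv S u a) u c)) := by
  obtain ⟨hρ, hS⟩ := isPlot_carrier_iff.1 hp
  have hd (a b : EuclideanSpace ℝ (Fin n)) : DifferentiableAt ℝ (fun u =>
      l2Form μ (dirDeriv (fun u => (p u).1.1) u a) (dirDeriv (fun u => (p u).1.2) u b)) u :=
    ((hρ.dirDeriv a).contDiff_l2Form μ (hS.dirDeriv b)).differentiable (by simp) u
  rw [funext (pullbackCoeff_wassersteinForm p a b), fderiv_fun_sub (hd a b) (hd b a),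
    sub_apply, (hρ.dirDeriv a).fderiv_l2Form μ (hS.dirDeriv b),
    (hρ.dirDeriv b).fderiv_l2Form μ (hS.dirDeriv a)]

theorem isSymplecticForm_wassersteinForm [μ.IsOpenPosMeasure] :
    (cotangentBundle (d := d) μ).IsSymplecticForm (wassersteinForm μ) where
  add_left z v _ v' _ w _ := by
    simp only [wassersteinForm_eq, Prod.fst_add, Prod.snd_add, map_add, LinearMap.add_apply]
    ring
  smul_left z r v _ w _ := by
    simp only [wassersteinForm_eq, Prod.smul_fst, Prod.smul_snd, map_smul, LinearMap.smul_apply,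
      smul_eq_mul]
    ring
  skew z v _ w _ := by
    simp only [wassersteinForm_eq, neg_sub]
  descends _ _ _ _ hc₁ hc₂ hc₁' hc₂' _ _ hr₁ hr₂ :=
    wassersteinForm_descends hc₁ hc₂ hc₁' hc₂' hr₁ hr₂
  nondegenerate _ _ _ := mem_vertical_of_wassersteinForm_eq_zero
  smooth _ _ := contDiff_pullbackCoeff_wassersteinForm
  closed n p hp a b c u := by
    obtain ⟨hρ, hS⟩ := isPlot_carrier_iff.1 hp
    simp only [fderiv_pullbackCoeff_wassersteinForm hp]
    rw [hρ.dirDeriv_comm u b a, hρ.dirDeriv_comm u c a, hρ.dirDeriv_comm u c b,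
      hS.dirDeriv_comm u b a, hS.dirDeriv_comm u c a, hS.dirDeriv_comm u c b]
    ring

end Wasserstein

/-- The linear map `(a, b) ↦ (a + b, a - b)` between the first variations `(δF(η), δF(η^*))` and
the pair `(δF(ρ), S)`. -/
noncomputable def sumDiffEquiv (E : Type*) [AddCommGroup E] [Module ℝ E] : (E × E) ≃ₗ[ℝ] E × E where
  toFun z := (z.1 + z.2, z.1 - z.2)
  invFun q := ((1 / 2 : ℝ) • (q.1 + q.2), (1 / 2 : ℝ) • (q.1 - q.2))
  map_add' z z' := Prod.ext (add_add_add_comm ..) (add_sub_add_comm ..)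
  map_smul' r z := Prod.ext (smul_add r _ _).symm (smul_sub r _ _).symm
  left_inv z := Prod.ext (by module) (by module)
  right_inv q := Prod.ext (by module) (by module)

namespace InvertiblePotential

variable {d : ℕ} {M : Type*} [TopologicalSpace M] [ChartedSpace (EuclideanSpace ℝ (Fin d)) M]
  [MeasurableSpace M] {μ : Measure M} (Φ : InvertiblePotential d μ)

theorem fst_mem_dom {z : SmoothFn d M × SmoothFn d M} (hz : z ∈ Φ.hopfColeSpace.carrier) :
    z.1 ∈ Φ.dom := by
  obtain ⟨ρ, -, S, h, -⟩ := hz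
  exact h ▸ Φ.δFinv_mem _

theorem snd_mem_dom {z : SmoothFn d M × SmoothFn d M} (hz : z ∈ Φ.hopfColeSpace.carrier) :
    z.2 ∈ Φ.dom := by
  obtain ⟨ρ, -, S, -, h⟩ := hz
  exact h ▸ Φ.δFinv_mem _

theorem δF_density (z : SmoothFn d M × SmoothFn d M) :
    Φ.δF (Φ.density z) = Φ.δF z.1 + Φ.δF z.2 :=
  Φ.δF_δFinv _

theorem density_mem_dom (z : SmoothFn d M × SmoothFn d M) : Φ.density z ∈ Φ.dom :=
  Φ.δFinv_mem _

/-- The generalized Hopf–Cole transformation as a bijection of representatives: in the coordinates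
`(δF(η), δF(η^*))` and `(δF(ρ), S)` it is `sumDiffEquiv`. -/
noncomputable def hopfColeEquiv :
    Φ.hopfColeSpace.carrier ≃ (cotangentBundle (d := d) μ).carrier where
  toFun := Φ.hopfCole
  invFun q :=
    ⟨((sumDiffEquiv _).symm (Φ.δF q.1.1, q.1.2)).map Φ.δFinv Φ.δFinv, q.1.1, q.2, q.1.2, rfl, rfl⟩
  left_inv z := by
    have h : (sumDiffEquiv _).symm (Φ.δF (Φ.density z.1), Φ.δF z.1.1 - Φ.δF z.1.2) =
        (Φ.δF z.1.1, Φ.δF z.1.2) := by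
      rw [δF_density]
      exact (sumDiffEquiv _).symm_apply_apply (Φ.δF z.1.1, Φ.δF z.1.2)
    exact Subtype.ext ((congrArg (Prod.map Φ.δFinv Φ.δFinv) h).trans
      (Prod.ext (Φ.δFinv_δF (Φ.fst_mem_dom z.2)) (Φ.δFinv_δF (Φ.snd_mem_dom z.2))))
  right_inv q := by
    have h := (sumDiffEquiv _).apply_symm_apply (Φ.δF q.1.1, q.1.2)
    refine Subtype.ext (Prod.ext ?_ ?_)
    · simp only [hopfCole, density, Prod.map_fst, Prod.map_snd, δF_δFinv]
      exact (congrArg (Φ.δFinv ∘ Prod.fst) h).trans (Φ.δFinv_δF (Φ.densities_subset q.2))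
    · simp only [hopfCole, Prod.map_fst, Prod.map_snd, δF_δFinv]
      exact congrArg Prod.snd h

theorem rel_hopfCole_iff (z z' : Φ.hopfColeSpace.carrier) :
    Φ.hopfColeSpace.rel z z' ↔ (cotangentBundle μ).rel (Φ.hopfCole z) (Φ.hopfCole z') := by
  constructor
  · rintro ⟨k, hk⟩
    refine ⟨congrArg Φ.δFinv (ContMDiffMap.ext fun x => ?_), 2 * k, fun x => ?_⟩
    · change Φ.δF z.1.1 x + Φ.δF z.1.2 x = Φ.δF z'.1.1 x + Φ.δF z'.1.2 x
      linarith [hk x]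
    · change Φ.δF z'.1.1 x - Φ.δF z'.1.2 x = Φ.δF z.1.1 x - Φ.δF z.1.2 x + 2 * k
      linarith [hk x]
  · rintro ⟨hρ, k, hS⟩
    have hsum : Φ.δF z.1.1 + Φ.δF z.1.2 = Φ.δF z'.1.1 + Φ.δF z'.1.2 := by
      rw [← δF_density, ← δF_density]
      exact congrArg Φ.δF hρ
    refine ⟨k / 2, fun x => ?_⟩
    have hsum_x : Φ.δF z.1.1 x + Φ.δF z.1.2 x = Φ.δF z'.1.1 x + Φ.δF z'.1.2 x :=
      DFunLike.congr_fun hsum x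
    have hdiff_x : Φ.δF z'.1.1 x - Φ.δF z'.1.2 x = Φ.δF z.1.1 x - Φ.δF z.1.2 x + k := hS x
    constructor <;> linarith

theorem dSmooth_hopfCole : DSmooth Φ.hopfCole := fun n p hp => by
  obtain ⟨hη, hη'⟩ := isPlot_carrier_iff.1 hp
  have hα := Φ.isSmoothOn_δF.smoothFamily_comp hη fun u => Φ.fst_mem_dom (p u).2
  have hβ := Φ.isSmoothOn_δF.smoothFamily_comp hη' fun u => Φ.snd_mem_dom (p u).2
  exact isPlot_carrier_iff.2
    ⟨Φ.isSmoothOn_δFinv.smoothFamily_comp (hα.add hβ) fun _ => trivial, hα.sub hβ⟩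

theorem dSmooth_hopfColeEquiv_symm : DSmooth Φ.hopfColeEquiv.symm := fun n p hp => by
  obtain ⟨hρ, hS⟩ := isPlot_carrier_iff.1 hp
  have hf := Φ.isSmoothOn_δF.smoothFamily_comp hρ fun u => Φ.densities_subset (p u).2
  exact isPlot_carrier_iff.2
    ⟨Φ.isSmoothOn_δFinv.smoothFamily_comp (.smul contDiff_const (hf.add hS)) fun _ => trivial,
      Φ.isSmoothOn_δFinv.smoothFamily_comp (.smul contDiff_const (hf.sub hS)) fun _ => trivial⟩

variable [IsManifold (𝓡 d) ∞ M]

/-- The differential of the generalized Hopf–Cole transformation at `(η, η^*)`, extended to all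
pairs of functions. -/
noncomputable def hopfColeDifferential (z : Φ.hopfColeSpace.carrier) :
    (SmoothFn d M × SmoothFn d M) ≃ₗ[ℝ] SmoothFn d M × SmoothFn d M :=
  (Φ.hessian (Φ.fst_mem_dom z.2)).prodCongr (Φ.hessian (Φ.snd_mem_dom z.2)) ≪≫ₗ
    sumDiffEquiv _ ≪≫ₗ (Φ.hessian (Φ.density_mem_dom z.1)).symm.prodCongr (.refl ℝ _)

theorem hopfColeDifferential_apply (z : Φ.hopfColeSpace.carrier)
    (v : SmoothFn d M × SmoothFn d M) :
    Φ.hopfColeDifferential z v =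
      ((Φ.hessian (Φ.density_mem_dom z.1)).symm
        (Φ.hessian (Φ.fst_mem_dom z.2) v.1 + Φ.hessian (Φ.snd_mem_dom z.2) v.2),
       Φ.hessian (Φ.fst_mem_dom z.2) v.1 - Φ.hessian (Φ.snd_mem_dom z.2) v.2) :=
  rfl

theorem vel_hopfCole {c : ℝ → Φ.hopfColeSpace.carrier} (hc : DSmooth c) :
    (cotangentBundle μ).vel (fun t => Φ.hopfCole (c t)) =
      Φ.hopfColeDifferential (c 0) (Φ.hopfColeSpace.vel c) := by
  obtain ⟨hη, hη'⟩ := dSmooth_carrier_iff.1 hc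
  have hα := Φ.isSmoothOn_δF.smoothFamily_comp hη fun t => Φ.fst_mem_dom (c t).2
  have hβ := Φ.isSmoothOn_δF.smoothFamily_comp hη' fun t => Φ.snd_mem_dom (c t).2
  have vα := Φ.hasVelocity_δF_comp hη (Φ.fst_mem_dom (c 0).2)
  have vβ := Φ.hasVelocity_δF_comp hη' (Φ.snd_mem_dom (c 0).2)
  have vρ := Φ.isSmoothOn_δFinv.hasVelocity_comp ((hα.add hβ).smoothFamilyAt 0) trivial (vα.add vβ)
  rw [← δF_density, ← coe_hessian_symm Φ (Φ.density_mem_dom _)] at vρ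
  exact PhaseSpace.vel_eq _ vρ (vα.sub vβ)

/-- The generalized Hopf–Cole transformation as a diffeomorphism `C(M) → T^*P(M)`. -/
noncomputable def hopfColeDiffeo : PhaseSpace.Diffeo Φ.hopfColeSpace (cotangentBundle μ) where
  toEquiv := Φ.hopfColeEquiv
  dSmooth := Φ.dSmooth_hopfCole
  dSmooth_symm := Φ.dSmooth_hopfColeEquiv_symm
  rel_iff := Φ.rel_hopfCole_iff
  differential := Φ.hopfColeDifferential
  vel_comp _ := Φ.vel_hopfCole

variable [CompactSpace M] [OpensMeasurableSpace M] [IsFiniteMeasure μ]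

theorem hopfColeForm_eq (z : Φ.hopfColeSpace.carrier) (v w : SmoothFn d M × SmoothFn d M) :
    Φ.hopfColeForm z v w =
      -2 * (l2Form μ ((Φ.hessian (Φ.density_mem_dom z.1)).symm (Φ.hessian (Φ.fst_mem_dom z.2) v.1))
          (Φ.hessian (Φ.snd_mem_dom z.2) w.2) -
        l2Form μ ((Φ.hessian (Φ.density_mem_dom z.1)).symm (Φ.hessian (Φ.fst_mem_dom z.2) w.1))
          (Φ.hessian (Φ.snd_mem_dom z.2) v.2)) := by
  rw [hopfColeForm, integral_mul_sub_mul]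
  simp only [Φ.invFun_sigma_apply (Φ.fst_mem_dom z.2) (Φ.snd_mem_dom z.2) (Φ.density_mem_dom z.1),
    map_smul, LinearMap.smul_apply, l2Form_hessian_left, smul_eq_mul]
  ring

theorem hopfColeForm_eq_wassersteinForm (z : Φ.hopfColeSpace.carrier)
    (v w : SmoothFn d M × SmoothFn d M) :
    Φ.hopfColeForm z v w = wassersteinForm μ (Φ.hopfCole z) (Φ.hopfColeDifferential z v)
      (Φ.hopfColeDifferential z w) := by
  have hρ := Φ.density_mem_dom z.1
  -- `B` is symmetric, so in the pull-back of `ω^W` only the mixed terms survive.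
  let B (f g : SmoothFn d M) : ℝ := l2Form μ ((Φ.hessian hρ).symm f) g
  have hB (f g : SmoothFn d M) : B f g = B g f :=
    (Φ.l2Form_hessian_symm_left hρ f g).trans (l2Form_comm μ _ _)
  rw [hopfColeForm_eq, wassersteinForm_eq, hopfColeDifferential_apply, hopfColeDifferential_apply]
  generalize Φ.hessian (Φ.fst_mem_dom z.2) v.1 = a
  generalize Φ.hessian (Φ.snd_mem_dom z.2) v.2 = b
  generalize Φ.hessian (Φ.fst_mem_dom z.2) w.1 = a'
  generalize Φ.hessian (Φ.snd_mem_dom z.2) w.2 = b'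
  simp only [map_add, map_sub, LinearMap.add_apply]
  linarith [hB a a', hB b b', hB b a', hB a b']

end InvertiblePotential

end HopfCole

theorem mainTheorem1_general {d : ℕ} {M : Type*} [TopologicalSpace M] [CompactSpace M]
    [ChartedSpace (EuclideanSpace ℝ (Fin d)) M] [IsManifold (𝓡 d) ∞ M]
    [MeasurableSpace M] [OpensMeasurableSpace M]
    (μ : Measure M) [IsFiniteMeasure μ] [μ.IsOpenPosMeasure]
    (Φ : HopfCole.InvertiblePotential d μ) :
    (∀ η ∈ Φ.dom, Function.Bijective (Φ.secondVariation η)) ∧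
    (∀ z ∈ Φ.hopfColeSpace.carrier, Function.Bijective (Φ.sigma z)) ∧
    (∀ z : Φ.hopfColeSpace.carrier,
      Φ.δF (Φ.hopfCole z).1.1 = Φ.δF z.1.1 + Φ.δF z.1.2 ∧
      (Φ.hopfCole z).1.2 = Φ.δF z.1.1 - Φ.δF z.1.2) ∧
    HopfCole.PhaseSpace.IsSymplectomorphism Φ.hopfColeSpace (HopfCole.cotangentBundle μ)
      Φ.hopfColeForm (HopfCole.wassersteinForm μ) Φ.hopfCole :=
  ⟨fun _ hη => (Φ.hessian hη).bijective,
    fun _ hz => Φ.coe_sigmaEquiv (Φ.fst_mem_dom hz) (Φ.snd_mem_dom hz) ▸ LinearEquiv.bijective _,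
    fun z => ⟨Φ.δF_density z.1, rfl⟩,
    Φ.hopfColeDiffeo.isSymplectomorphism Φ.hopfColeForm_eq_wassersteinForm
      HopfCole.isSymplecticForm_wassersteinForm⟩

theorem mainTheorem1 {d : ℕ} {M : Type*} [TopologicalSpace M] [T2Space M] [CompactSpace M]
    [ChartedSpace (EuclideanSpace ℝ (Fin d)) M] [IsManifold (𝓡 d) ∞ M]
    [MeasurableSpace M] [BorelSpace M]
    (μ : Measure M) [IsFiniteMeasure μ] [μ.IsOpenPosMeasure]
    (Φ : HopfCole.InvertiblePotential d μ) :
    (∀ η ∈ Φ.dom, Function.Bijective (Φ.secondVariation η)) ∧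
    (∀ z ∈ Φ.hopfColeSpace.carrier, Function.Bijective (Φ.sigma z)) ∧
    (∀ z : Φ.hopfColeSpace.carrier,
      Φ.δF (Φ.hopfCole z).1.1 = Φ.δF z.1.1 + Φ.δF z.1.2 ∧
      (Φ.hopfCole z).1.2 = Φ.δF z.1.1 - Φ.δF z.1.2) ∧
    HopfCole.PhaseSpace.IsSymplectomorphism Φ.hopfColeSpace (HopfCole.cotangentBundle μ)
      Φ.hopfColeForm (HopfCole.wassersteinForm μ) Φ.hopfCole :=
  mainTheorem1_general μ Φ
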